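/- Let $k$ be a field, let $H$ be a Hopf algebra over $k$, and let $B$ be a Hopf algebra in the category ${}_H^H\mathcal{YD}$ of left-left Yetter-Drinfel'd modules over $H$. That is, $B$ is a $k$-algebra and a $k$-coalgebra with a left $H$-module structure (compatible with its $k$-vector space structure) and a left $H$-comodule structure $\rho(b) = b_{(-1)} \otimes b_{(0)}$ such that $B$ is a left $H$-module algebra and coalgebra and a left $H$-comodule algebra and coalgebra, $\epsilon : B \to k$ is an algebra map, $\Delta(1) = 1 \otimes 1$, $$\Delta(bb') = b_{(1)}(b_{(2)(-1)}\cdot b'_{(1)}) \otimes b_{(2)(0)}b'_{(2)}, \qquad h_{(1)}b_{(-1)} \otimes h_{(2)}\cdot b_{(0)} = (h_{(1)}\cdot b)_{(-1)}h_{(2)} \otimes (h_{(1)}\cdot b)_{(0)}$$ for all $b, b' \in B$ and $h \in H$, and $\mathrm{Id}_B$ has a convolution inverse. Let $A = B \times H$ be the biproduct: the vector space $B \otimes H$, with $b \otimes h$ written $b \times h$, which is a Hopf algebra over $k$ with $$(b \times h)(b' \times h') = b(h_{(1)}\cdot b') \times h_{(2)}h', \qquad \Delta(b \times h) = (b_{(1)}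 \times b_{(2)(-1)}h_{(1)}) \otimes (b_{(2)(0)} \times h_{(2)}),$$ unit $1 \times 1$ and counit $\epsilon(b \times h) = \epsilon(b)\epsilon(h)$. Let $\pi : A \to H$, $\pi(b \times h) = \epsilon(b)h$, and $j : H \to A$, $j(h) = 1 \times h$. Let $\mathrm{End}_{\mathcal{YD}-\mathrm{Hopf}}(B)$ be the monoid, under composition, of all linear endomorphisms of $B$ which are algebra and coalgebra maps and also maps of left $H$-modules and left $H$-comodules, and let $\mathrm{Aut}_{\mathcal{YD}-\mathrm{Hopf}}(B)$ be its group of units. Let $\mathrm{End}_{\mathrm{Hopf}}(A, \pi, j)$ be the monoid, under composition, of all Hopf algebra endomorphisms $F$ of $A$ such that $\pi \circ F = \pi$ and $F \circ j = j$, and let $\mathrm{Aut}_{\mathrm{Hopf}}(A, \pi, j)$ be the group of all Hopf algebra automorphisms $F$ of $A$ with these two properties. Then there is an isomorphism of monoids $\mathrm{End}_{\mathcal{YD}-\mathrm{Hopf}}(B) \simeq \mathrm{End}_{\mathrm{Hopf}}(A, \pi, j)$ and an isomorphism of groups $\mathrm{Aut}_{\mathcal{YD}-\mathrm{Hopf}}(B)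 \simeq \mathrm{Aut}_{\mathrm{Hopf}}(A, \pi, j)$, each given by $f \mapsto F$, where $F(b \times h) = f(b) \times h$ for all $b \in B$ and $h \in H$. -/

import Mathlib

open scoped TensorProduct

universe u v w

set_option linter.unusedSectionVars false
set_option linter.unusedSimpArgs false
set_option linter.style.longLine false

namespace YD

open TensorProduct (zero_tmul tmul_zero add_tmul tmul_add)

theorem tensor_ind {k M N : Type*} [CommSemiring k] [AddCommMonoid M] [Module k M]
    [AddCommMonoid N] [Module k N] {motive : M ⊗[k] N → Prop} (t : M ⊗[k] N)
    (tmul : ∀ m n, motive (m ⊗ₜ n)) (add : ∀ x y, motive x → motive y → motive (x + y)) :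
    motive t :=
  TensorProduct.induction_on t (by simpa using tmul 0 0) tmul add

/-- A left comodule `(M, ρ)` over a coalgebra `C`. -/
class LeftComodule (k : Type u) (C : Type v) (M : Type w) [CommSemiring k]
    [AddCommMonoid C] [Module k C] [Coalgebra k C] [AddCommMonoid M] [Module k M] where
  coaction : M →ₗ[k] C ⊗[k] M
  coassoc : TensorProduct.assoc k C C M ∘ₗ Coalgebra.comul.rTensor M ∘ₗ coaction
    = coaction.lTensor C ∘ₗ coaction
  counit_coaction : (Coalgebra.counit (R := k) (A := C)).rTensor M ∘ₗ coaction
    = TensorProduct.mk k k M 1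

/-- If `R` acts on `M` and `S` acts on `N`, then `R ⊗ S` acts on `M ⊗ N`, by
`(r ⊗ s)(m ⊗ n) = r • m ⊗ s • n`. -/
noncomputable def tensorAct (k : Type*) {R S : Type*} (M N : Type*) [CommSemiring k]
    [Semiring R] [Algebra k R] [Semiring S] [Algebra k S]
    [AddCommMonoid M] [Module k M] [Module R M] [IsScalarTower k R M]
    [AddCommMonoid N] [Module k N] [Module S N] [IsScalarTower k S N] :
    R ⊗[k] S →ₐ[k] Module.End k (M ⊗[k] N) :=
  (Module.endTensorEndAlgHom (R := k) (A := k) (M := M) (N := N)).comp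
    (Algebra.TensorProduct.map (Algebra.lsmul k k M) (Algebra.lsmul k k N))

section
variable {k R S M N : Type*} [CommSemiring k]
    [Semiring R] [Algebra k R] [Semiring S] [Algebra k S]
    [AddCommMonoid M] [Module k M] [Module R M] [IsScalarTower k R M]
    [AddCommMonoid N] [Module k N] [Module S N] [IsScalarTower k S N]

@[simp] lemma tensorAct_tmul_tmul (r : R) (s : S) (m : M) (n : N) :
    tensorAct k M N (r ⊗ₜ[k] s) (m ⊗ₜ[k] n) = (r • m) ⊗ₜ[k] (s • n) := by
  simp [tensorAct, Module.endTensorEndAlgHom_apply]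
end

/-- `(h ⊗ m) ⊗ (h' ⊗ n) ↦ h h' ⊗ (m ⊗ n)`. -/
noncomputable def mulFirst (k H M N : Type*) [CommSemiring k] [Semiring H] [Algebra k H]
    [AddCommMonoid M] [Module k M] [AddCommMonoid N] [Module k N] :
    (H ⊗[k] M) ⊗[k] (H ⊗[k] N) →ₗ[k] H ⊗[k] (M ⊗[k] N) :=
  (LinearMap.mul' k H).rTensor (M ⊗[k] N) ∘ₗ
    (TensorProduct.tensorTensorTensorComm k H M H N).toLinearMap

/-- Given `ρ : M → H ⊗ M` and `σ : N → H ⊗ N`, the map `M ⊗ N → H ⊗ (M ⊗ N)`,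
`m ⊗ n ↦ m₍₋₁₎ n₍₋₁₎ ⊗ (m₍₀₎ ⊗ n₍₀₎)`. -/
noncomputable def codiag {k H M N : Type*} [CommSemiring k] [Semiring H] [Algebra k H]
    [AddCommMonoid M] [Module k M] [AddCommMonoid N] [Module k N]
    (ρ : M →ₗ[k] H ⊗[k] M) (σ : N →ₗ[k] H ⊗[k] N) :
    M ⊗[k] N →ₗ[k] H ⊗[k] (M ⊗[k] N) :=
  mulFirst k H M N ∘ₗ TensorProduct.map ρ σ

section
variable {k H M N : Type*} [CommSemiring k] [Semiring H] [Algebra k H]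
    [AddCommMonoid M] [Module k M] [AddCommMonoid N] [Module k N]

@[simp] lemma mulFirst_tmul (h h' : H) (m : M) (n : N) :
    mulFirst k H M N ((h ⊗ₜ m) ⊗ₜ (h' ⊗ₜ n)) = (h * h') ⊗ₜ (m ⊗ₜ n) := by
  simp [mulFirst]

@[simp] lemma codiag_tmul (ρ : M →ₗ[k] H ⊗[k] M) (σ : N →ₗ[k] H ⊗[k] N) (m : M) (n : N) :
    codiag ρ σ (m ⊗ₜ[k] n) = mulFirst k H M N (ρ m ⊗ₜ[k] σ n) := rfl
end

/-- `(s ⊗ t) ↦ (s · m)₍₋₁₎ t ⊗ (s · m)₍₀₎`. -/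
noncomputable def actCoact {k H M : Type*} [CommSemiring k] [Semiring H] [Algebra k H]
    [AddCommMonoid M] [Module k M] [Module H M] [IsScalarTower k H M]
    (ρ : M →ₗ[k] H ⊗[k] M) (m : M) : H ⊗[k] H →ₗ[k] H ⊗[k] M :=
  TensorProduct.lift (LinearMap.mk₂ k
    (fun s t => (LinearMap.mulRight k t).rTensor M (ρ (s • m)))
    (fun s s' t => by rw [add_smul, map_add, map_add])
    (fun c s t => by rw [smul_assoc, map_smul, map_smul])
    (fun s t t' => by
      rw [← LinearMap.add_apply, ← LinearMap.rTensor_add]; congr 2; ext; simp [mul_add])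
    (fun c s t => by
      rw [← LinearMap.smul_apply, ← LinearMap.rTensor_smul]; congr 2; ext; simp))

@[simp] lemma actCoact_tmul {k H M : Type*} [CommSemiring k] [Semiring H] [Algebra k H]
    [AddCommMonoid M] [Module k M] [Module H M] [IsScalarTower k H M]
    (ρ : M →ₗ[k] H ⊗[k] M) (m : M) (s t : H) :
    actCoact ρ m (s ⊗ₜ[k] t) = (LinearMap.mulRight k t).rTensor M (ρ (s • m)) := rfl

/-- `(b ⊗ c)(b' ⊗ c') = b (c₍₋₁₎ · b') ⊗ c₍₀₎ c'`: the multiplication of the braided tensor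
product `B ⊗ B`. -/
noncomputable def braidedMul {k H B : Type*} [CommSemiring k] [Semiring H] [Algebra k H]
    [Semiring B] [Algebra k B] [Module H B] [IsScalarTower k H B]
    (ρ : B →ₗ[k] H ⊗[k] B) : B ⊗[k] B →ₗ[k] Module.End k (B ⊗[k] B) :=
  TensorProduct.lift <| (LinearMap.mul k (Module.End k (B ⊗[k] B))).compl₁₂
    ((tensorAct k B B).comp
      (Algebra.TensorProduct.includeLeft : B →ₐ[k] B ⊗[k] B)).toLinearMap
    ((tensorAct k (R := H) (S := B) B B).toLinearMap ∘ₗ ρ)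

lemma braidedMul_tmul {k H B : Type*} [CommSemiring k] [Semiring H] [Algebra k H]
    [Semiring B] [Algebra k B] [Module H B] [IsScalarTower k H B]
    (ρ : B →ₗ[k] H ⊗[k] B) (b c : B) (x : B ⊗[k] B) :
    braidedMul ρ (b ⊗ₜ[k] c) x =
      (LinearMap.mulLeft k b).rTensor B (tensorAct k B B (ρ c) x) := by
  simp only [braidedMul, TensorProduct.lift.tmul, LinearMap.compl₁₂_apply, LinearMap.mul_apply',
    Module.End.mul_apply, LinearMap.comp_apply, AlgHom.toLinearMap_apply, AlgHom.comp_apply]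
  generalize tensorAct k B B (ρ c) x = y
  induction y using tensor_ind with
  | tmul _ _ => simp
  | add _ _ h h' => simp only [map_add, h, h']

section Structures

open Coalgebra

variable (k : Type u) (H : Type v) (B : Type w) [Field k] [Ring H] [HopfAlgebra k H]
  [Ring B] [Algebra k B] [Coalgebra k B] [Module H B] [IsScalarTower k H B]

/-- `B` is a Hopf algebra of the category of left-left Yetter-Drinfel'd modules over `H`: it is a
left `H`-module algebra and coalgebra, a left `H`-comodule algebra and coalgebra, its action and
coaction satisfy the Yetter-Drinfel'd condition, `ε` is multiplicative, `Δ(1) = 1 ⊗ 1`,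
`Δ(b b') = b₍₁₎ (b₍₂₎₍₋₁₎ · b'₍₁₎) ⊗ b₍₂₎₍₀₎ b'₍₂₎`, and the identity of `B` has a convolution
inverse. -/
class YDHopf [LeftComodule k H B] : Prop where
  /-- `h · 1 = ε(h) 1` -/
  smul_one (h : H) : h • (1 : B) = counit (R := k) h • (1 : B)
  /-- `h · (b b') = (h₍₁₎ · b) (h₍₂₎ · b')` -/
  smul_mul (h : H) (b b' : B) :
    h • (b * b') = LinearMap.mul' k B (tensorAct k B B (comul (R := k) h) (b ⊗ₜ b'))
  /-- `ε(h · b) = ε(h) ε(b)` -/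
  counit_smul (h : H) (b : B) : counit (R := k) (h • b) = counit (R := k) h * counit (R := k) b
  /-- `Δ(h · b) = h₍₁₎ · b₍₁₎ ⊗ h₍₂₎ · b₍₂₎` -/
  comul_smul (h : H) (b : B) :
    comul (R := k) (h • b) = tensorAct k B B (comul (R := k) h) (comul (R := k) b)
  /-- `ρ(1) = 1 ⊗ 1` -/
  coaction_one : LeftComodule.coaction (k := k) (C := H) (1 : B) = 1 ⊗ₜ[k] 1
  /-- `ρ(b b') = b₍₋₁₎ b'₍₋₁₎ ⊗ b₍₀₎ b'₍₀₎` -/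
  coaction_mul (b b' : B) : LeftComodule.coaction (k := k) (C := H) (b * b') =
    LeftComodule.coaction (k := k) (C := H) b * LeftComodule.coaction (k := k) (C := H) b'
  /-- `b₍₋₁₎ ε(b₍₀₎) = ε(b) 1` -/
  coaction_counit (b : B) : (TensorProduct.rid k H)
      ((counit (R := k) (A := B)).lTensor H (LeftComodule.coaction b)) =
    counit (R := k) b • (1 : H)
  /-- `b₍₁₎₍₋₁₎ b₍₂₎₍₋₁₎ ⊗ b₍₁₎₍₀₎ ⊗ b₍₂₎₍₀₎ = b₍₋₁₎ ⊗ b₍₀₎₍₁₎ ⊗ b₍₀₎₍₂₎` -/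
  coaction_comul (b : B) :
    codiag (LeftComodule.coaction (k := k) (C := H)) (LeftComodule.coaction (k := k) (C := H))
      (comul (R := k) b) = (comul (R := k) (A := B)).lTensor H (LeftComodule.coaction b)
  /-- `h₍₁₎ b₍₋₁₎ ⊗ h₍₂₎ · b₍₀₎ = (h₍₁₎ · b)₍₋₁₎ h₍₂₎ ⊗ (h₍₁₎ · b)₍₀₎` -/
  yetterDrinfeld (h : H) (b : B) :
    tensorAct k H B (comul (R := k) h) (LeftComodule.coaction b) =
      actCoact (LeftComodule.coaction (k := k) (C := H)) b (comul (R := k) h)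
  counit_one : counit (R := k) (1 : B) = 1
  counit_mul (b b' : B) : counit (R := k) (b * b') = counit (R := k) b * counit (R := k) b'
  comul_one : comul (R := k) (1 : B) = 1 ⊗ₜ[k] 1
  comul_mul (b b' : B) : comul (R := k) (b * b') =
    braidedMul (LeftComodule.coaction (k := k) (C := H)) (comul (R := k) b) (comul (R := k) b')
  /-- the identity of `B` has a convolution inverse -/
  exists_convInverse : ∃ S : B →ₗ[k] B,
    LinearMap.mul' k B ∘ₗ S.rTensor B ∘ₗ comul = Algebra.linearMap k B ∘ₗ counit ∧
    LinearMap.mul' k B ∘ₗ S.lTensor B ∘ₗ comul = Algebra.linearMap k B ∘ₗ counit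


variable {k H B}

/-- `h ↦ h • m` as a linear map. -/
noncomputable def actAt (k : Type*) {H M : Type*} [CommSemiring k] [Semiring H] [Algebra k H]
    [AddCommMonoid M] [Module k M] [Module H M] [IsScalarTower k H M] (m : M) : H →ₗ[k] M :=
  (Algebra.lsmul k k M).toLinearMap.flip m

@[simp] lemma actAt_apply {k H M : Type*} [CommSemiring k] [Semiring H] [Algebra k H]
    [AddCommMonoid M] [Module k M] [Module H M] [IsScalarTower k H M] (m : M) (h : H) :
    actAt k m h = h • m := rfl

lemma tensorAct_apply_tmul {k R S M N : Type*} [CommSemiring k]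
    [Semiring R] [Algebra k R] [Semiring S] [Algebra k S]
    [AddCommMonoid M] [Module k M] [Module R M] [IsScalarTower k R M]
    [AddCommMonoid N] [Module k N] [Module S N] [IsScalarTower k S N]
    (t : R ⊗[k] S) (m : M) (n : N) :
    tensorAct k M N t (m ⊗ₜ n) = TensorProduct.map (actAt k m) (actAt k n) t := by
  induction t using tensor_ind with
  | tmul _ _ => simp
  | add _ _ h h' => simp only [map_add, LinearMap.add_apply, h, h']

/-- `b ⊗ h ↦ (b' ⊗ h' ↦ b (h₍₁₎ · b') ⊗ h₍₂₎ h')`. -/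
noncomputable def smashOp (k : Type u) (H : Type v) (B : Type w) [Field k] [Ring H]
    [HopfAlgebra k H] [Ring B] [Algebra k B] [Module H B] [IsScalarTower k H B] :
    B ⊗[k] H →ₗ[k] Module.End k (B ⊗[k] H) :=
  TensorProduct.lift <| (LinearMap.mul k (Module.End k (B ⊗[k] H))).compl₁₂
    ((tensorAct k (R := B) (S := H) B H).comp
      (Algebra.TensorProduct.includeLeft : B →ₐ[k] B ⊗[k] H)).toLinearMap
    ((tensorAct k (R := H) (S := H) B H).toLinearMap ∘ₗ comul)

lemma smashOp_tmul (b : B) (h : H) :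
    smashOp k H B (b ⊗ₜ[k] h) =
      tensorAct k B H (b ⊗ₜ[k] (1 : H)) * tensorAct k B H (comul (R := k) h) := rfl

lemma smashOp_tmul_tmul_one_right (b b' : B) (h' : H) :
    smashOp k H B (b ⊗ₜ[k] 1) (b' ⊗ₜ[k] h') = (b * b') ⊗ₜ[k] h' := by
  simp [smashOp_tmul, Algebra.TensorProduct.one_def]

lemma smashOp_tmul_mul (b : B) (h h' : H) :
    smashOp k H B (b ⊗ₜ[k] (h * h')) = smashOp k H B (b ⊗ₜ[k] h) *
      tensorAct k B H (comul (R := k) h') := by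
  simp [smashOp_tmul, mul_assoc]

lemma smashOp_mul_tmul (b b' : B) (h : H) :
    smashOp k H B ((b * b') ⊗ₜ[k] h) = tensorAct k B H (b ⊗ₜ[k] (1 : H)) *
      smashOp k H B (b' ⊗ₜ[k] h) := by
  rw [smashOp_tmul, smashOp_tmul, ← mul_assoc, ← map_mul, Algebra.TensorProduct.tmul_mul_tmul,
    one_mul]

variable [LeftComodule k H B] [YDHopf k H B]

lemma smashOp_act_one (h : H) (b : B) :
    smashOp k H B (tensorAct k B H (comul (R := k) h) (b ⊗ₜ 1)) =
      tensorAct k B H (comul (R := k) h) * tensorAct k B H (b ⊗ₜ[k] (1 : H)) := by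
  apply TensorProduct.ext'
  intro b' g
  let T : H ⊗[k] (H ⊗[k] H) →ₗ[k] B ⊗[k] H :=
    TensorProduct.map (LinearMap.mul' k B ∘ₗ TensorProduct.map (actAt k b) (actAt k b'))
      (actAt k g) ∘ₗ (TensorProduct.assoc k H H H).symm.toLinearMap
  have h1 : ∀ t : H ⊗[k] H, smashOp k H B (tensorAct k B H t (b ⊗ₜ 1)) (b' ⊗ₜ[k] g) =
      T ((comul (R := k)).lTensor H t) := by
    intro t
    induction t using tensor_ind with
    | add _ _ h h' => simp only [map_add, LinearMap.add_apply, h, h']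
    | tmul s u =>
      simp only [tensorAct_tmul_tmul, smashOp_tmul, Module.End.mul_apply, smul_eq_mul, mul_one,
        LinearMap.lTensor_tmul]
      generalize comul (R := k) u = v
      induction v using tensor_ind with
      | add _ _ h h' => simp only [map_add, LinearMap.add_apply, h, h', tmul_add]
      | tmul x y => simp [T]
  have h2 : ∀ t : H ⊗[k] H, tensorAct k B H t ((b * b') ⊗ₜ g) =
      T (TensorProduct.assoc k H H H ((comul (R := k)).rTensor H t)) := by
    intro t
    induction t using tensor_ind with
    | add _ _ h h' => simp only [map_add, LinearMap.add_apply, h, h']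
    | tmul s u =>
      simp [T, YDHopf.smul_mul (k := k), tensorAct_apply_tmul]
  rw [h1, ← coassoc_apply, ← h2]
  simp

lemma smashOp_act (h : H) (y : B ⊗[k] H) :
    smashOp k H B (tensorAct k B H (comul (R := k) h) y) =
      tensorAct k B H (comul (R := k) h) * smashOp k H B y := by
  induction y using tensor_ind with
  | add _ _ h h' => simp only [map_add, h, h', mul_add]
  | tmul b g =>
    have : ∀ t : H ⊗[k] H, smashOp k H B (tensorAct k B H t (b ⊗ₜ g)) =
        smashOp k H B (tensorAct k B H t (b ⊗ₜ 1)) * tensorAct k B H (comul (R := k) g) := by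
      intro t
      induction t using tensor_ind with
      | add _ _ h h' => simp only [map_add, LinearMap.add_apply, h, h', add_mul]
      | tmul s u => simp [← smashOp_tmul_mul]
    rw [this, smashOp_act_one, smashOp_tmul, mul_assoc]

lemma smashOp_left (b : B) (y : B ⊗[k] H) :
    smashOp k H B (tensorAct k B H (b ⊗ₜ[k] (1 : H)) y) =
      tensorAct k B H (b ⊗ₜ[k] (1 : H)) * smashOp k H B y := by
  induction y using tensor_ind with
  | add _ _ h h' => simp only [map_add, h, h', mul_add]
  | tmul b g => simp [smashOp_mul_tmul]

lemma smashOp_smashOp (x y : B ⊗[k] H) :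
    smashOp k H B (smashOp k H B x y) = smashOp k H B x * smashOp k H B y := by
  induction x using tensor_ind with
  | add _ _ h h' => simp only [map_add, LinearMap.add_apply, h, h', add_mul]
  | tmul b h =>
    rw [smashOp_tmul, Module.End.mul_apply, smashOp_left, smashOp_act, mul_assoc]

lemma smashOp_one : smashOp k H B (1 ⊗ₜ 1) = 1 := by
  rw [smashOp_tmul]
  simp [← Algebra.TensorProduct.one_def]

lemma smashOp_apply_one (x : B ⊗[k] H) : smashOp k H B x (1 ⊗ₜ 1) = x := by
  induction x using tensor_ind with
  | add _ _ h h' => simp only [map_add, LinearMap.add_apply, h, h']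
  | tmul b h =>
    have : ∀ t : H ⊗[k] H, tensorAct k B H t (1 ⊗ₜ 1) =
       TensorProduct.map (Algebra.linearMap k B) LinearMap.id ((counit (R := k)).rTensor H t) := by
      intro t
      induction t using tensor_ind with
      | add _ _ h h' => simp only [map_add, LinearMap.add_apply, h, h']
      | tmul s u => simp [YDHopf.smul_one (k := k), Algebra.algebraMap_eq_smul_one]
    rw [smashOp_tmul, Module.End.mul_apply, this, rTensor_counit_comul]
    simp

end Structures

section Coalg
open Coalgebra
variable {k : Type u} {H : Type v} {B : Type w} [Field k] [Ring H] [HopfAlgebra k H]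
  [Ring B] [Algebra k B] [Coalgebra k B] [Module H B] [IsScalarTower k H B] [LeftComodule k H B]

/-- `b ⊗ h ↦ b₍₋₁₎ h₍₁₎ ⊗ (b₍₀₎ ⊗ h₍₂₎)`. -/
noncomputable def lam (k : Type u) (H : Type v) (B : Type w) [Field k] [Ring H]
    [HopfAlgebra k H] [Ring B] [Algebra k B] [LeftComodule k H B] :
    B ⊗[k] H →ₗ[k] H ⊗[k] (B ⊗[k] H) :=
  codiag LeftComodule.coaction comul

/-- `b ⊗ h ↦ (b₍₁₎ ⊗ b₍₂₎₍₋₁₎ h₍₁₎) ⊗ (b₍₂₎₍₀₎ ⊗ h₍₂₎)`. -/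
noncomputable def smashComul (k : Type u) (H : Type v) (B : Type w) [Field k] [Ring H]
    [HopfAlgebra k H] [Ring B] [Algebra k B] [Coalgebra k B] [LeftComodule k H B] :
    B ⊗[k] H →ₗ[k] (B ⊗[k] H) ⊗[k] (B ⊗[k] H) :=
  (TensorProduct.assoc k B H (B ⊗[k] H)).symm.toLinearMap ∘ₗ (lam k H B).lTensor B ∘ₗ
    (TensorProduct.assoc k B B H).toLinearMap ∘ₗ (comul (R := k) (A := B)).rTensor H

/-- `b ⊗ h ↦ ε(b) ε(h)`. -/
noncomputable def smashCounit (k : Type u) (H : Type v) (B : Type w) [Field k] [Ring H]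
    [HopfAlgebra k H] [Ring B] [Algebra k B] [Coalgebra k B] :
    B ⊗[k] H →ₗ[k] k :=
  LinearMap.mul' k k ∘ₗ TensorProduct.map counit counit

lemma lam_tmul (b : B) (h : H) : lam k H B (b ⊗ₜ h) =
    mulFirst k H B H (LeftComodule.coaction b ⊗ₜ comul (R := k) h) := rfl

lemma lam_coassoc (n : B ⊗[k] H) :
    TensorProduct.assoc k H H _ ((comul (R := k)).rTensor _ (lam k H B n)) =
      (lam k H B).lTensor H (lam k H B n) := by
  induction n using tensor_ind with
  | add _ _ h h' => simp only [LinearMap.map_add, LinearEquiv.map_add, h, h']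
  | tmul b h =>
    have h1 : ∀ (t : H ⊗[k] B) (u : H ⊗[k] H),
        TensorProduct.assoc k H H _ ((comul (R := k)).rTensor _ (mulFirst k H B H (t ⊗ₜ u))) =
        (mulFirst k H B H).lTensor H (mulFirst k H _ _
          (TensorProduct.assoc k H H B ((comul (R := k)).rTensor _ t) ⊗ₜ
            TensorProduct.assoc k H H H ((comul (R := k)).rTensor _ u))) := by
      intro t u
      induction t using tensor_ind with
      | add _ _ h h' => simp only [LinearMap.map_add, LinearEquiv.map_add, h, h', add_tmul]
      | tmul x b' =>
        induction u using tensor_ind with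
        | add _ _ h h' => simp only [LinearMap.map_add, LinearEquiv.map_add, h, h', tmul_add]
        | tmul y h' =>
          simp only [mulFirst_tmul, LinearMap.rTensor_tmul, Bialgebra.comul_mul]
          generalize comul (R := k) x = p
          generalize comul (R := k) y = q
          induction p using tensor_ind with
          | add _ _ h h' => simp only [LinearMap.map_add, LinearEquiv.map_add, h, h', add_tmul, add_mul]
          | tmul _ _ =>
            induction q using tensor_ind with
            | add _ _ h h' => simp only [LinearMap.map_add, LinearEquiv.map_add, h, h', add_tmul,
                tmul_add, mul_add]
            | tmul _ _ => simp
    have h2 : ∀ (t : H ⊗[k] B) (u : H ⊗[k] H),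
        (lam k H B).lTensor H (mulFirst k H B H (t ⊗ₜ u)) =
        (mulFirst k H B H).lTensor H (mulFirst k H _ _
          (LeftComodule.coaction.lTensor H t ⊗ₜ (comul (R := k)).lTensor H u)) := by
      intro t u
      induction t using tensor_ind with
      | add _ _ h h' => simp only [LinearMap.map_add, LinearEquiv.map_add, h, h', add_tmul]
      | tmul x b' =>
        induction u using tensor_ind with
        | add _ _ h h' => simp only [LinearMap.map_add, LinearEquiv.map_add, h, h', tmul_add]
        | tmul y h' => simp [lam_tmul]
    have h3 := LinearMap.congr_fun (LeftComodule.coassoc (k := k) (C := H) (M := B)) b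
    simp only [LinearMap.comp_apply, LinearEquiv.coe_coe] at h3
    rw [lam_tmul]
    refine (h1 _ _).trans (Eq.trans ?_ (h2 _ _).symm)
    rw [coassoc_apply, h3]

lemma lam_counit (n : B ⊗[k] H) :
    TensorProduct.lid k _ ((counit (R := k)).rTensor _ (lam k H B n)) = n := by
  induction n using tensor_ind with
  | add _ _ h h' => simp only [LinearMap.map_add, LinearEquiv.map_add, h, h']
  | tmul b h =>
    have h1 : ∀ (t : H ⊗[k] B) (u : H ⊗[k] H),
        TensorProduct.lid k _ ((counit (R := k)).rTensor _ (mulFirst k H B H (t ⊗ₜ u))) =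
        TensorProduct.lid k _ ((counit (R := k)).rTensor _ t) ⊗ₜ
        TensorProduct.lid k _ ((counit (R := k)).rTensor _ u) := by
      intro t u
      induction t using tensor_ind with
      | add _ _ h h' => simp only [LinearMap.map_add, LinearEquiv.map_add, h, h', add_tmul]
      | tmul x b' =>
        induction u using tensor_ind with
        | add _ _ h h' => simp only [LinearMap.map_add, LinearEquiv.map_add, h, h', tmul_add]
        | tmul y h' => simp [← TensorProduct.smul_tmul', smul_smul, mul_comm]
    have h3 := LinearMap.congr_fun (LeftComodule.counit_coaction (k := k) (C := H) (M := B)) b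
    simp only [LinearMap.comp_apply] at h3
    rw [lam_tmul, h1, h3]
    simp

variable [YDHopf k H B]

lemma lam_counit_right (b : B) (h : H) :
    TensorProduct.rid k _ ((smashCounit k H B).lTensor _ (lam k H B (b ⊗ₜ h))) =
      counit (R := k) b • h := by
  have h1 : ∀ (t : H ⊗[k] B) (u : H ⊗[k] H),
      TensorProduct.rid k _ ((smashCounit k H B).lTensor _ (mulFirst k H B H (t ⊗ₜ u))) =
      TensorProduct.rid k _ ((counit (R := k)).lTensor _ t) *
      TensorProduct.rid k _ ((counit (R := k)).lTensor _ u) := by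
    intro t u
    induction t using tensor_ind with
    | add _ _ h h' => simp only [LinearMap.map_add, LinearEquiv.map_add, h, h', add_tmul, add_mul]
    | tmul x b' =>
      induction u using tensor_ind with
      | add _ _ h h' => simp only [LinearMap.map_add, LinearEquiv.map_add, h, h', tmul_add, mul_add]
      | tmul y h' => simp [smashCounit, smul_smul, mul_comm]
  rw [lam_tmul, h1, YDHopf.coaction_counit]
  simp

lemma smashComul_tmul (b : B) (h : H) : smashComul k H B (b ⊗ₜ h) =
    (TensorProduct.assoc k B H (B ⊗[k] H)).symm ((lam k H B).lTensor B
      (TensorProduct.assoc k B B H (comul (R := k) b ⊗ₜ h))) := rfl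

lemma smashComul_coassoc (x : B ⊗[k] H) :
    TensorProduct.assoc k _ _ _ ((smashComul k H B).rTensor _ (smashComul k H B x)) =
      (smashComul k H B).lTensor _ (smashComul k H B x) := by
  induction x using tensor_ind with
  | add _ _ h h' => simp only [LinearMap.map_add, LinearEquiv.map_add, h, h']
  | tmul b h =>
    let U : B ⊗[k] ((H ⊗[k] B) ⊗[k] (H ⊗[k] (H ⊗[k] (B ⊗[k] H)))) →ₗ[k]
        (B ⊗[k] H) ⊗[k] ((B ⊗[k] H) ⊗[k] (B ⊗[k] H)) :=
      (TensorProduct.assoc k B H _).symm.toLinearMap ∘ₗ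
        ((TensorProduct.assoc k B H (B ⊗[k] H)).symm.toLinearMap.lTensor H ∘ₗ
          mulFirst k H B (H ⊗[k] (B ⊗[k] H))).lTensor B
    have hU : ∀ (c : B) p d y y' n, U (c ⊗ₜ ((p ⊗ₜ d) ⊗ₜ (y ⊗ₜ (y' ⊗ₜ n)))) =
        (c ⊗ₜ (p * y)) ⊗ₜ ((d ⊗ₜ y') ⊗ₜ n) := by
      intros; simp [U]
    let V : B ⊗[k] (B ⊗[k] B) →ₗ[k] (B ⊗[k] H) ⊗[k] ((B ⊗[k] H) ⊗[k] (B ⊗[k] H)) :=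
      U ∘ₗ (TensorProduct.map LeftComodule.coaction
        ((lam k H B).lTensor H ∘ₗ lam k H B ∘ₗ (TensorProduct.mk k B H).flip h)).lTensor B
    have hV : ∀ (c c' c'' : B), V (c ⊗ₜ (c' ⊗ₜ c'')) =
        U (c ⊗ₜ (LeftComodule.coaction c' ⊗ₜ (lam k H B).lTensor H (lam k H B (c'' ⊗ₜ h)))) := by
      intros; simp [V]
    have h1 : ∀ s : B ⊗[k] B, TensorProduct.assoc k _ _ _ ((smashComul k H B).rTensor _
        ((TensorProduct.assoc k B H (B ⊗[k] H)).symm ((lam k H B).lTensor B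
      (TensorProduct.assoc k B B H (s ⊗ₜ h))))) =
        V (TensorProduct.assoc k B B B ((comul (R := k)).rTensor _ s)) := by
      intro s
      induction s using tensor_ind with
      | add _ _ h h' => simp only [LinearMap.map_add, LinearEquiv.map_add, h, h', add_tmul]
      | tmul c c' =>
        simp only [TensorProduct.assoc_tmul, LinearMap.lTensor_tmul, LinearMap.rTensor_tmul]
        generalize hs : comul (R := k) c = s
        have : ∀ s : B ⊗[k] B, V (TensorProduct.assoc k B B B (s ⊗ₜ c')) =
          U ((TensorProduct.assoc k B _ _ (LeftComodule.coaction.lTensor B s ⊗ₜ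
            TensorProduct.assoc k H H _
              ((comul (R := k)).rTensor _ (lam k H B (c' ⊗ₜ h)))))) := by
          intro s
          induction s using tensor_ind with
          | add _ _ h h' => simp only [LinearMap.map_add, LinearEquiv.map_add, h, h', add_tmul]
          | tmul _ _ => simp [hV, lam_coassoc]
        rw [this]
        generalize lam k H B (c' ⊗ₜ h) = n
        induction n using tensor_ind with
        | add _ _ h h' => simp only [LinearMap.map_add, LinearEquiv.map_add, h, h', tmul_add]
        | tmul y n =>
          simp only [TensorProduct.assoc_symm_tmul, LinearMap.rTensor_tmul, smashComul_tmul, hs]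
          clear hs
          induction s using tensor_ind with
          | add _ _ h h' => simp only [LinearMap.map_add, LinearEquiv.map_add, h, h', add_tmul]
          | tmul c1 c2 =>
            simp only [TensorProduct.assoc_tmul, LinearMap.lTensor_tmul, lam_tmul]
            generalize comul (R := k) y = u
            generalize LeftComodule.coaction (k := k) (C := H) c2 = t
            induction t using tensor_ind with
            | add _ _ h h' => simp only [LinearMap.map_add, LinearEquiv.map_add, h, h', add_tmul,
                tmul_add]
            | tmul _ _ =>
              induction u using tensor_ind with
              | add _ _ h h' => simp only [LinearMap.map_add, LinearEquiv.map_add, h, h', add_tmul,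
                  tmul_add]
              | tmul _ _ => simp [hU]
    have h2 : ∀ s : B ⊗[k] B, (smashComul k H B).lTensor _
        ((TensorProduct.assoc k B H (B ⊗[k] H)).symm ((lam k H B).lTensor B
      (TensorProduct.assoc k B B H (s ⊗ₜ h)))) =
        V ((comul (R := k)).lTensor _ s) := by
      intro s
      induction s using tensor_ind with
      | add _ _ h h' => simp only [LinearMap.map_add, LinearEquiv.map_add, h, h', add_tmul]
      | tmul c c' =>
        simp only [TensorProduct.assoc_tmul, LinearMap.lTensor_tmul, lam_tmul]
        let X : H ⊗[k] (B ⊗[k] B) →ₗ[k] (B ⊗[k] H) ⊗[k] ((B ⊗[k] H) ⊗[k] (B ⊗[k] H)) :=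
          (TensorProduct.assoc k B H _).symm.toLinearMap ∘ₗ
          (TensorProduct.mk k B _ c) ∘ₗ
          ((TensorProduct.assoc k B H (B ⊗[k] H)).symm.toLinearMap ∘ₗ
           (lam k H B).lTensor B ∘ₗ (TensorProduct.assoc k B B H).toLinearMap).lTensor H ∘ₗ
          mulFirst k H (B ⊗[k] B) H ∘ₗ (TensorProduct.mk k _ _).flip (comul (R := k) h)
        have h3 : ∀ (t : H ⊗[k] B), (smashComul k H B).lTensor _
            ((TensorProduct.assoc k B H (B ⊗[k] H)).symm
              (c ⊗ₜ mulFirst k H B H (t ⊗ₜ comul (R := k) h))) =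
            X ((comul (R := k)).lTensor _ t) := by
          intro t
          simp only [X, LinearMap.comp_apply, LinearMap.flip_apply, TensorProduct.mk_apply]
          generalize comul (R := k) h = u
          induction t using tensor_ind with
          | add _ _ h h' => simp only [LinearMap.map_add, LinearEquiv.map_add, h, h', add_tmul,
              tmul_add]
          | tmul p d =>
            induction u using tensor_ind with
            | add _ _ h h' => simp only [LinearMap.map_add, LinearEquiv.map_add, h, h', tmul_add]
            | tmul _ _ => simp [smashComul_tmul]
        rw [h3, ← YDHopf.coaction_comul]
        generalize comul (R := k) c' = s
        induction s using tensor_ind with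
        | add _ _ h h' => simp only [LinearMap.map_add, LinearEquiv.map_add, h, h', tmul_add]
        | tmul d e =>
          simp only [X, LinearMap.comp_apply, LinearMap.flip_apply, TensorProduct.mk_apply, hV,
            codiag_tmul, lam_tmul]
          generalize LeftComodule.coaction (k := k) (C := H) d = p
          generalize LeftComodule.coaction (k := k) (C := H) e = q
          generalize comul (R := k) h = u
          induction u using tensor_ind with
          | add _ _ h h' => simp only [LinearMap.map_add, LinearEquiv.map_add, h, h', tmul_add]
          | tmul h1 h2 =>
            induction q using tensor_ind with
            | add _ _ h h' => simp only [LinearMap.map_add, LinearEquiv.map_add, h, h', tmul_add,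
                add_tmul]
            | tmul q e =>
              induction p using tensor_ind with
              | add _ _ h h' => simp only [LinearMap.map_add, LinearEquiv.map_add, h, h', tmul_add,
                  add_tmul]
              | tmul p d =>
                simp only [mulFirst_tmul, LinearMap.lTensor_tmul, LinearMap.comp_apply,
                  LinearEquiv.coe_coe, TensorProduct.assoc_tmul]
                generalize lam k H B (e ⊗ₜ h2) = w
                induction w using tensor_ind with
                | add _ _ h h' => simp only [LinearMap.map_add, LinearEquiv.map_add, h, h', tmul_add]
                | tmul y n => simp [hU, mul_assoc]
    rw [smashComul_tmul, h1, h2, coassoc_apply]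

lemma smashComul_counit_left (x : B ⊗[k] H) :
    (smashCounit k H B).rTensor _ (smashComul k H B x) = 1 ⊗ₜ x := by
  apply (TensorProduct.lid k _).injective
  induction x using tensor_ind with
  | add _ _ h h' => simp only [LinearMap.map_add, LinearEquiv.map_add, h, h', tmul_add]
  | tmul b h =>
    have h1 : ∀ s : B ⊗[k] B, TensorProduct.lid k _ ((smashCounit k H B).rTensor _
        ((TensorProduct.assoc k B H (B ⊗[k] H)).symm ((lam k H B).lTensor B
      (TensorProduct.assoc k B B H (s ⊗ₜ h))))) =
        TensorProduct.lid k _ ((counit (R := k)).rTensor _ s) ⊗ₜ h := by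
      intro s
      induction s using tensor_ind with
      | add _ _ h h' => simp only [LinearMap.map_add, LinearEquiv.map_add, h, h', add_tmul]
      | tmul c d =>
        simp only [TensorProduct.assoc_tmul, LinearMap.lTensor_tmul, LinearMap.rTensor_tmul,
          TensorProduct.lid_tmul]
        rw [← TensorProduct.smul_tmul']
        conv_rhs => rw [← lam_counit (k := k) (H := H) (B := B) (d ⊗ₜ h)]
        generalize lam k H B (d ⊗ₜ h) = w
        induction w using tensor_ind with
        | add _ _ h h' => simp only [LinearMap.map_add, LinearEquiv.map_add, h, h', tmul_add, smul_add]
        | tmul y n => simp [smashCounit, smul_smul]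
    rw [smashComul_tmul, h1, rTensor_counit_comul]
    simp

lemma smashComul_counit_right (x : B ⊗[k] H) :
    (smashCounit k H B).lTensor _ (smashComul k H B x) = x ⊗ₜ 1 := by
  apply (TensorProduct.rid k _).injective
  induction x using tensor_ind with
  | add _ _ h h' => simp only [LinearMap.map_add, LinearEquiv.map_add, h, h', add_tmul]
  | tmul b h =>
    have h1 : ∀ s : B ⊗[k] B, TensorProduct.rid k _ ((smashCounit k H B).lTensor _
        ((TensorProduct.assoc k B H (B ⊗[k] H)).symm ((lam k H B).lTensor B
      (TensorProduct.assoc k B B H (s ⊗ₜ h))))) =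
        TensorProduct.rid k _ ((counit (R := k)).lTensor _ s) ⊗ₜ h := by
      intro s
      induction s using tensor_ind with
      | add _ _ h h' => simp only [LinearMap.map_add, LinearEquiv.map_add, h, h', add_tmul]
      | tmul c d =>
        simp only [TensorProduct.assoc_tmul, LinearMap.lTensor_tmul, TensorProduct.rid_tmul]
        rw [TensorProduct.smul_tmul, ← lam_counit_right]
        generalize lam k H B (d ⊗ₜ h) = w
        induction w using tensor_ind with
        | add _ _ h h' => simp only [LinearMap.map_add, LinearEquiv.map_add, h, h', tmul_add]
        | tmul y n => simp [smashCounit]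
    rw [smashComul_tmul, h1, lTensor_counit_comul]
    simp

end Coalg


/-- The underlying space `B ⊗ H` of the biproduct `B × H`. -/
def Biproduct (k : Type u) (H : Type v) (B : Type w) [Field k] [Ring H] [HopfAlgebra k H]
  [Ring B] [Algebra k B] : Type (max v w) := B ⊗[k] H

namespace Biproduct

section

variable (k : Type u) (H : Type v) (B : Type w) [Field k] [Ring H] [HopfAlgebra k H]
  [Ring B] [Algebra k B]

noncomputable instance : AddCommGroup (Biproduct k H B) :=
  inferInstanceAs (AddCommGroup (B ⊗[k] H))

noncomputable instance : Module k (Biproduct k H B) :=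
  inferInstanceAs (Module k (B ⊗[k] H))

/-- The identification of `B ⊗ H` with `B × H`; the element `b × h` is `of k H B (b ⊗ₜ h)`. -/
noncomputable def of : B ⊗[k] H ≃ₗ[k] Biproduct k H B := LinearEquiv.refl k _

end

section

open Coalgebra

variable {k : Type u} {H : Type v} {B : Type w} [Field k] [Ring H] [HopfAlgebra k H]
  [Ring B] [Algebra k B] [Coalgebra k B] [Module H B] [IsScalarTower k H B]
  [LeftComodule k H B] [YDHopf k H B]

/-- The smash product `(b × h)(b' × h') = b (h₍₁₎ · b') × h₍₂₎ h'`. -/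
noncomputable instance : Mul (Biproduct k H B) where
  mul x y := of k H B (smashOp k H B ((of k H B).symm x) ((of k H B).symm y))

noncomputable instance : One (Biproduct k H B) where
  one := of k H B (1 ⊗ₜ 1)

lemma mul_def (x y : Biproduct k H B) :
    x * y = of k H B (smashOp k H B ((of k H B).symm x) ((of k H B).symm y)) := rfl

lemma one_def : (1 : Biproduct k H B) = of k H B (1 ⊗ₜ 1) := rfl

noncomputable instance : Ring (Biproduct k H B) :=
  { (inferInstance : AddCommGroup (Biproduct k H B)) with
    mul_assoc := fun x y z => by simp [mul_def, smashOp_smashOp]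
    one_mul := fun x => by simp [mul_def, one_def, smashOp_one]
    mul_one := fun x => by simp [mul_def, one_def, smashOp_apply_one]
    left_distrib := fun x y z => by simp [mul_def]
    right_distrib := fun x y z => by simp [mul_def]
    zero_mul := fun x => by simp [mul_def]
    mul_zero := fun x => by simp [mul_def] }

noncomputable instance : Algebra k (Biproduct k H B) :=
  Algebra.ofModule (fun r x y => by simp [mul_def]) (fun r x y => by simp [mul_def])


/-- The smash coproduct `Δ(b × h) = (b₍₁₎ × b₍₂₎₍₋₁₎ h₍₁₎) ⊗ (b₍₂₎₍₀₎ × h₍₂₎)`,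
`ε(b × h) = ε(b) ε(h)`. -/
noncomputable instance : Coalgebra k (Biproduct k H B) where
  comul := smashComul k H B
  counit := smashCounit k H B
  coassoc := LinearMap.ext smashComul_coassoc
  rTensor_counit_comp_comul := LinearMap.ext smashComul_counit_left
  lTensor_counit_comp_comul := LinearMap.ext smashComul_counit_right

lemma comul_of (x : B ⊗[k] H) : comul (R := k) (of k H B x) =
    TensorProduct.map (of k H B).toLinearMap (of k H B).toLinearMap (smashComul k H B x) :=
  (LinearMap.congr_fun (TensorProduct.map_id (R := k) (M := B ⊗[k] H) (N := B ⊗[k] H))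
    (smashComul k H B x)).symm

lemma counit_of (b : B) (h : H) :
    counit (R := k) (of k H B (b ⊗ₜ h)) = counit (R := k) b * counit (R := k) h := rfl

/-- `b ↦ b × 1`. -/
noncomputable def inclB (k : Type u) (H : Type v) (B : Type w) [Field k] [Ring H]
    [HopfAlgebra k H] [Ring B] [Algebra k B] : B →ₗ[k] Biproduct k H B :=
  (of k H B).toLinearMap ∘ₗ (TensorProduct.mk k B H).flip 1

/-- The inclusion `j : H → B × H`, `j(h) = 1 × h`. -/
noncomputable def j (k : Type u) (H : Type v) (B : Type w) [Field k] [Ring H]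
    [HopfAlgebra k H] [Ring B] [Algebra k B] : H →ₗ[k] Biproduct k H B :=
  (of k H B).toLinearMap ∘ₗ TensorProduct.mk k B H 1

/-- The projection `π : B × H → H`, `π(b × h) = ε(b) h`. -/
noncomputable def π (k : Type u) (H : Type v) (B : Type w) [Field k] [Ring H]
    [HopfAlgebra k H] [Ring B] [Algebra k B] [Coalgebra k B] : Biproduct k H B →ₗ[k] H :=
  (TensorProduct.lid k H).toLinearMap ∘ₗ (counit (R := k) (A := B)).rTensor H ∘ₗ
    (of k H B).symm.toLinearMap

@[simp] lemma π_of (b : B) (h : H) : π k H B (of k H B (b ⊗ₜ h)) = counit (R := k) b • h := by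
  simp [π]

lemma of_mul_of (x y : B ⊗[k] H) :
    of k H B x * of k H B y = of k H B (smashOp k H B x y) := rfl

lemma smashOp_one_tmul (h : H) :
    smashOp k H B (1 ⊗ₜ h) = tensorAct k B H (comul (R := k) h) := by
  rw [smashOp_tmul]
  change tensorAct k B H 1 * _ = _
  rw [map_one, one_mul]

lemma of_mul_j (b : B) (h g : H) :
    of k H B (b ⊗ₜ h) * j k H B g = of k H B (b ⊗ₜ (h * g)) := by
  have h1 := smashOp_apply_one (k := k) (b ⊗ₜ[k] (h * g))
  have h2 := smashOp_apply_one (k := k) ((1 : B) ⊗ₜ[k] g)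
  rw [smashOp_one_tmul] at h2
  rw [smashOp_tmul_mul, Module.End.mul_apply, h2] at h1
  rw [← h1]
  rfl

lemma inclB_mul_of (b b' : B) (h : H) :
    inclB k H B b * of k H B (b' ⊗ₜ h) = of k H B ((b * b') ⊗ₜ h) := by
  rw [← smashOp_tmul_tmul_one_right]
  rfl

lemma inclB_mul_j (b : B) (h : H) : inclB k H B b * j k H B h = of k H B (b ⊗ₜ h) := by
  rw [show j k H B h = of k H B (1 ⊗ₜ h) from rfl, inclB_mul_of, mul_one]

lemma inclB_mul (b b' : B) : inclB k H B (b * b') = inclB k H B b * inclB k H B b' :=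
  (inclB_mul_of b b' 1).symm

lemma j_mul (h h' : H) : j k H B (h * h') = j k H B h * j k H B h' :=
  (of_mul_j 1 h h').symm

lemma inclB_one : inclB k H B 1 = 1 := rfl

lemma j_one : j k H B 1 = 1 := rfl

lemma j_mul_of (h : H) (b : B) (g : H) :
    j k H B h * of k H B (b ⊗ₜ g) =
      of k H B (TensorProduct.map (actAt k b) (LinearMap.mulRight k g) (comul (R := k) h)) := by
  have h1 : (LinearMap.mulRight k g) = actAt (H := H) (M := H) k g := by ext; simp
  rw [h1, ← tensorAct_apply_tmul]
  rw [← smashOp_one_tmul]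
  rfl

@[simp] lemma of_symm_of (x : B ⊗[k] H) : (of k H B).symm (of k H B x) = x := rfl

theorem induction_of {p : Biproduct k H B → Prop} (x : Biproduct k H B)
    (h1 : ∀ b h, p (of k H B (b ⊗ₜ h))) (h2 : ∀ x y, p x → p y → p (x + y)) : p x :=
  tensor_ind (motive := fun y => p (of k H B y)) x h1 (fun _ _ => h2 _ _)

/-- `c ⊗ (y ⊗ d) ↦ (c × y) ⊗ (d × 1)`. -/
noncomputable def auxW (k : Type u) (H : Type v) (B : Type w) [Field k] [Ring H]
    [HopfAlgebra k H] [Ring B] [Algebra k B] [Coalgebra k B] [Module H B] [IsScalarTower k H B]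
    [LeftComodule k H B] [YDHopf k H B] :
    B ⊗[k] (H ⊗[k] B) →ₗ[k] Biproduct k H B ⊗[k] Biproduct k H B :=
  TensorProduct.map (of k H B).toLinearMap (inclB k H B) ∘ₗ
    (TensorProduct.assoc k B H B).symm.toLinearMap

lemma auxW_tmul (c : B) (y : H) (d : B) : auxW k H B (c ⊗ₜ (y ⊗ₜ d)) =
    of k H B (c ⊗ₜ y) ⊗ₜ inclB k H B d := rfl

lemma comul_inclB (b : B) : comul (R := k) (inclB k H B b) =
    auxW k H B (LeftComodule.coaction.lTensor B (comul (R := k) b)) := by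
  change comul (R := k) (of k H B (b ⊗ₜ 1)) = _
  rw [comul_of, smashComul_tmul]
  generalize comul (R := k) b = s
  induction s using tensor_ind with
  | add _ _ h h' => simp only [LinearMap.map_add, LinearEquiv.map_add, add_tmul, h, h']
  | tmul c d =>
    simp only [TensorProduct.assoc_tmul, LinearMap.lTensor_tmul, lam_tmul, Bialgebra.comul_one,
      Algebra.TensorProduct.one_def]
    generalize LeftComodule.coaction (k := k) (C := H) d = t
    induction t using tensor_ind with
    | add _ _ h h' =>
      simp only [LinearMap.map_add, LinearEquiv.map_add, add_tmul, tmul_add, h, h']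
    | tmul y d =>
      rw [mulFirst_tmul, TensorProduct.assoc_symm_tmul, TensorProduct.map_tmul, auxW_tmul, mul_one]
      rfl

lemma comul_j (h : H) : comul (R := k) (j k H B h) =
    TensorProduct.map (j k H B) (j k H B) (comul (R := k) h) := by
  change comul (R := k) (of k H B (1 ⊗ₜ h)) = _
  rw [comul_of, smashComul_tmul, YDHopf.comul_one (k := k) (H := H)]
  simp only [TensorProduct.assoc_tmul, LinearMap.lTensor_tmul, lam_tmul,
    YDHopf.coaction_one (k := k) (H := H) (B := B)]
  generalize comul (R := k) h = t
  induction t using tensor_ind with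
  | add _ _ h h' =>
    simp only [LinearMap.map_add, LinearEquiv.map_add, add_tmul, tmul_add, h, h']
  | tmul y d =>
    rw [mulFirst_tmul, TensorProduct.assoc_symm_tmul, TensorProduct.map_tmul, one_mul]
    rfl

lemma comul_mul_j (b : B) (h g : H) :
    comul (R := k) (of k H B (b ⊗ₜ h) * j k H B g) =
      comul (R := k) (of k H B (b ⊗ₜ h)) * comul (R := k) (j k H B g) := by
  rw [of_mul_j, comul_j, comul_of, comul_of, smashComul_tmul, smashComul_tmul]
  generalize comul (R := k) b = s
  induction s using tensor_ind with
  | add _ _ h h' => simp only [LinearMap.map_add, LinearEquiv.map_add, add_tmul, h, h', add_mul]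
  | tmul c d =>
    simp only [TensorProduct.assoc_tmul, LinearMap.lTensor_tmul, lam_tmul, Bialgebra.comul_mul]
    generalize LeftComodule.coaction (k := k) (C := H) d = t
    generalize comul (R := k) h = u
    generalize comul (R := k) g = v
    induction t using tensor_ind with
    | add _ _ h h' =>
      simp only [LinearMap.map_add, LinearEquiv.map_add, add_tmul, tmul_add, add_mul, h, h']
    | tmul y d =>
      induction u using tensor_ind with
      | add _ _ h h' =>
        simp only [LinearMap.map_add, LinearEquiv.map_add, add_tmul, tmul_add, add_mul, h, h']
      | tmul h1 h2 =>
        induction v using tensor_ind with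
        | add _ _ h h' =>
          simp only [LinearMap.map_add, LinearEquiv.map_add, add_tmul, tmul_add, mul_add, h, h']
        | tmul g1 g2 =>
          rw [Algebra.TensorProduct.tmul_mul_tmul, mulFirst_tmul, mulFirst_tmul,
            TensorProduct.assoc_symm_tmul, TensorProduct.assoc_symm_tmul, TensorProduct.map_tmul,
            TensorProduct.map_tmul, TensorProduct.map_tmul, Algebra.TensorProduct.tmul_mul_tmul]
          simp only [LinearEquiv.coe_coe, of_mul_j, mul_assoc]

lemma comul_inclB_mul_inclB (b b' : B) :
    comul (R := k) (inclB k H B (b * b')) =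
      comul (R := k) (inclB k H B b) * comul (R := k) (inclB k H B b') := by
  rw [comul_inclB, comul_inclB, comul_inclB, YDHopf.comul_mul (k := k) (H := H)]
  generalize comul (R := k) b = s
  generalize comul (R := k) b' = t
  induction s using tensor_ind with
  | add _ _ h h' => simp only [LinearMap.map_add, LinearMap.add_apply, add_mul, h, h']
  | tmul c d =>
    induction t using tensor_ind with
    | add _ _ h h' => simp only [LinearMap.map_add, mul_add, h, h']
    | tmul c' d' =>
      let R (v : H ⊗[k] B) : H ⊗[k] (H ⊗[k] B) →ₗ[k] Biproduct k H B ⊗[k] Biproduct k H B :=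
        auxW k H B ∘ₗ
          TensorProduct.map (LinearMap.mulLeft k c ∘ₗ actAt k c') (LinearMap.mulRight k v)
      have h1 : ∀ r : H ⊗[k] B, auxW k H B (LeftComodule.coaction.lTensor B
          ((LinearMap.mulLeft k c).rTensor B (tensorAct k B B r (c' ⊗ₜ d')))) =
          R (LeftComodule.coaction d') (LeftComodule.coaction.lTensor H r) := by
        intro r
        induction r using tensor_ind with
        | add _ _ h h' => simp only [map_add, LinearMap.add_apply, h, h']
        | tmul y e => simp [R, YDHopf.coaction_mul (k := k) (H := H)]
      have h2 : ∀ r v : H ⊗[k] B, auxW k H B (c ⊗ₜ r) * auxW k H B (c' ⊗ₜ v) =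
          R v (TensorProduct.assoc k H H B ((comul (R := k)).rTensor B r)) := by
        intro r v
        simp only [R, LinearMap.comp_apply]
        induction r using tensor_ind with
        | add _ _ h h' => simp only [LinearMap.map_add, LinearEquiv.map_add, tmul_add, add_mul, h, h']
        | tmul y e =>
          induction v using tensor_ind with
          | add v v' h h' =>
            have : LinearMap.mulRight k (v + v') =
              LinearMap.mulRight k v + LinearMap.mulRight k v' := by ext; simp [mul_add]
            simp only [LinearMap.map_add, tmul_add, mul_add, h, h', this,
              TensorProduct.map_add_right, LinearMap.add_apply]
          | tmul q e' =>
            rw [auxW_tmul, auxW_tmul, Algebra.TensorProduct.tmul_mul_tmul, ← inclB_mul,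
              ← inclB_mul_j c y, mul_assoc, j_mul_of, LinearMap.rTensor_tmul]
            generalize comul (R := k) y = w
            induction w using tensor_ind with
            | add _ _ h h' =>
              simp only [LinearMap.map_add, LinearEquiv.map_add, add_tmul, mul_add, h, h']
            | tmul y1 y2 => simp [inclB_mul_of, auxW_tmul]
      have h3 := LinearMap.congr_fun (LeftComodule.coassoc (k := k) (C := H) (M := B)) d
      simp only [LinearMap.comp_apply, LinearEquiv.coe_coe] at h3
      rw [braidedMul_tmul, h1, ← h3, ← h2]
      rfl

/-- `(s₁ ⊗ s₂) ⊗ (u₁ ⊗ u₂) ↦ s₁ ⊗ ((s₂ ⊗ u₁) ⊗ u₂)`. -/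
noncomputable def middle (k : Type u) (H : Type v) [Field k] [Ring H] [Algebra k H] :
    (H ⊗[k] H) ⊗[k] (H ⊗[k] H) →ₗ[k] H ⊗[k] ((H ⊗[k] H) ⊗[k] H) :=
  (TensorProduct.assoc k H H H).symm.toLinearMap.lTensor H ∘ₗ
    (TensorProduct.assoc k H H (H ⊗[k] H)).toLinearMap

lemma middle_tmul (a b c d : H) :
    middle k H ((a ⊗ₜ b) ⊗ₜ (c ⊗ₜ d)) = a ⊗ₜ ((b ⊗ₜ c) ⊗ₜ d) := rfl

lemma middle_comul (h : H) :
    middle k H (TensorProduct.map comul comul (comul (R := k) h)) =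
      ((comul (R := k)).rTensor H).lTensor H ((comul (R := k)).lTensor H (comul (R := k) h)) := by
  have h1 : ∀ t : H ⊗[k] H, TensorProduct.assoc k H H (H ⊗[k] H)
      (TensorProduct.map comul comul t) = ((comul (R := k)).lTensor H).lTensor H
        (TensorProduct.assoc k H H H ((comul (R := k)).rTensor H t)) := by
    intro t
    induction t using tensor_ind with
    | add _ _ h h' => simp only [LinearMap.map_add, LinearEquiv.map_add, h, h']
    | tmul s u =>
      rw [TensorProduct.map_tmul, LinearMap.rTensor_tmul]
      generalize comul (R := k) s = w
      induction w using tensor_ind with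
      | add _ _ h h' => simp only [LinearMap.map_add, LinearEquiv.map_add, add_tmul, h, h']
      | tmul _ _ => rfl
  have h2 : ∀ t : H ⊗[k] H, (TensorProduct.assoc k H H H).symm.toLinearMap.lTensor H
      (((comul (R := k)).lTensor H).lTensor H ((comul (R := k)).lTensor H t)) =
      ((comul (R := k)).rTensor H).lTensor H ((comul (R := k)).lTensor H t) := by
    intro t
    induction t using tensor_ind with
    | add _ _ h h' => simp only [LinearMap.map_add, h, h']
    | tmul s u =>
      simp only [LinearMap.lTensor_tmul, LinearEquiv.coe_coe, coassoc_symm_apply]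
  rw [middle, LinearMap.comp_apply, LinearEquiv.coe_coe, h1, coassoc_apply, h2]

lemma comul_j_mul_inclB (h : H) (b : B) :
    comul (R := k) (j k H B h * inclB k H B b) =
      comul (R := k) (j k H B h) * comul (R := k) (inclB k H B b) := by
  let K (c : B) (f : H ⊗[k] H →ₗ[k] H ⊗[k] B) :
      H ⊗[k] ((H ⊗[k] H) ⊗[k] H) →ₗ[k] (B ⊗[k] H) ⊗[k] (B ⊗[k] H) :=
    (TensorProduct.assoc k B H (B ⊗[k] H)).symm.toLinearMap ∘ₗ
      TensorProduct.map (actAt k c) ((TensorProduct.assoc k H B H).toLinearMap ∘ₗ f.rTensor H)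
  have hK : ∀ (c : B) (f f' : H ⊗[k] H →ₗ[k] H ⊗[k] B) (t : H ⊗[k] H),
      (∀ x : H, f (comul (R := k) x) = f' (comul (R := k) x)) →
      K c f (((comul (R := k)).rTensor H).lTensor H ((comul (R := k)).lTensor H t)) =
      K c f' (((comul (R := k)).rTensor H).lTensor H ((comul (R := k)).lTensor H t)) := by
    intro c f f' t hff
    have : (f.rTensor H) ∘ₗ (comul (R := k)).rTensor H =
      (f'.rTensor H) ∘ₗ (comul (R := k)).rTensor H := by
      rw [← LinearMap.rTensor_comp, ← LinearMap.rTensor_comp]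
      congr 1
      exact LinearMap.ext hff
    induction t using tensor_ind with
    | add _ _ h h' => simp only [LinearMap.map_add, h, h']
    | tmul s u =>
      simp only [K, LinearMap.comp_apply, LinearMap.lTensor_tmul, TensorProduct.map_tmul]
      rw [show ∀ z, (f.rTensor H) ((comul (R := k)).rTensor H z) =
        (f'.rTensor H) ((comul (R := k)).rTensor H z) from LinearMap.congr_fun this]
  let A (s : B ⊗[k] B) : (H ⊗[k] H) ⊗[k] H →ₗ[k] (B ⊗[k] H) ⊗[k] (B ⊗[k] H) :=
    (TensorProduct.assoc k B H (B ⊗[k] H)).symm.toLinearMap ∘ₗ (lam k H B).lTensor B ∘ₗ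
      (TensorProduct.assoc k B B H).toLinearMap ∘ₗ
        ((tensorAct k (R := H) (S := H) B B).toLinearMap.flip s).rTensor H
  have hA0 : A 0 = 0 := by simp [A]
  have hA : ∀ s s', A (s + s') = A s + A s' := by
    intro s s'
    simp only [A, LinearMap.map_add, LinearMap.rTensor_add, LinearMap.comp_add]
  have s1 : ∀ t : H ⊗[k] H, smashComul k H B (TensorProduct.map (actAt k b) LinearMap.id t) =
      A (comul (R := k) b) ((comul (R := k)).rTensor H t) := by
    intro t
    induction t using tensor_ind with
    | add _ _ h h' => simp only [LinearMap.map_add, h, h']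
    | tmul x u =>
      rw [TensorProduct.map_tmul, smashComul_tmul, actAt_apply, YDHopf.comul_smul]
      rfl
  have s2 : ∀ (c d : B) (t : H ⊗[k] H), A (c ⊗ₜ d) ((comul (R := k)).rTensor H t) =
      K c (actCoact (LeftComodule.coaction (k := k) (C := H)) d)
        (middle k H (TensorProduct.map comul comul t)) := by
    intro c d t
    induction t using tensor_ind with
    | add _ _ h h' => simp only [LinearMap.map_add, h, h']
    | tmul x u =>
      simp only [A, LinearMap.comp_apply, LinearMap.rTensor_tmul, TensorProduct.map_tmul]
      generalize comul (R := k) x = p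
      induction p using tensor_ind with
      | add _ _ h h' => simp only [LinearMap.map_add, LinearEquiv.map_add, add_tmul, h, h']
      | tmul p q =>
        simp only [LinearMap.flip_apply, AlgHom.toLinearMap_apply, tensorAct_tmul_tmul,
          LinearEquiv.coe_coe, TensorProduct.assoc_tmul, LinearMap.lTensor_tmul, lam_tmul]
        generalize comul (R := k) u = v
        induction v using tensor_ind with
        | add _ _ h h' => simp only [LinearMap.map_add, LinearEquiv.map_add, tmul_add, h, h']
        | tmul u v =>
          simp only [K, middle_tmul, LinearMap.comp_apply, TensorProduct.map_tmul,
            LinearMap.rTensor_tmul, actCoact_tmul, actAt_apply]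
          generalize LeftComodule.coaction (k := k) (C := H) (q • d) = r
          induction r using tensor_ind with
          | add _ _ h h' =>
            simp only [LinearMap.map_add, LinearEquiv.map_add, tmul_add, add_tmul, h, h']
          | tmul y e => simp
  have s4 : ∀ (c : B) (r : H ⊗[k] B) (t : H ⊗[k] H),
      TensorProduct.map (of k H B).toLinearMap (of k H B).toLinearMap
        (K c ((tensorAct k (R := H) (S := H) H B).toLinearMap.flip r)
          (middle k H (TensorProduct.map comul comul t))) =
      TensorProduct.map (j k H B) (j k H B) t * auxW k H B (c ⊗ₜ r) := by
    intro c r t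
    simp only [K, LinearMap.comp_apply]
    induction r using tensor_ind with
    | add _ _ h h' => simp only [LinearMap.map_add, LinearMap.rTensor_add, LinearMap.comp_add,
        TensorProduct.map_add_right, LinearMap.add_apply, tmul_add, mul_add, h, h']
    | tmul y e =>
      induction t using tensor_ind with
      | add _ _ h h' => simp only [LinearMap.map_add, add_mul, h, h']
      | tmul x u =>
        rw [TensorProduct.map_tmul, TensorProduct.map_tmul, auxW_tmul,
          Algebra.TensorProduct.tmul_mul_tmul, j_mul_of,
          show inclB k H B e = of k H B (e ⊗ₜ 1) from rfl, j_mul_of]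
        generalize comul (R := k) x = v
        generalize comul (R := k) u = w
        induction v using tensor_ind with
        | add _ _ h h' => simp only [LinearMap.map_add, LinearEquiv.map_add, add_tmul, h, h']
        | tmul _ _ =>
          induction w using tensor_ind with
          | add _ _ h h' => simp only [LinearMap.map_add, LinearEquiv.map_add, tmul_add, h, h']
          | tmul _ _ => simp [middle_tmul]
  have key : ∀ s : B ⊗[k] B, TensorProduct.map (of k H B).toLinearMap (of k H B).toLinearMap
      (A s ((comul (R := k)).rTensor H (comul (R := k) h))) =
      TensorProduct.map (j k H B) (j k H B) (comul (R := k) h) *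
        auxW k H B (LeftComodule.coaction.lTensor B s) := by
    intro s
    induction s using tensor_ind with
    | add _ _ h h' => simp only [hA, LinearMap.map_add, LinearMap.add_apply, mul_add, h, h']
    | tmul c d =>
      rw [s2, LinearMap.lTensor_tmul, ← s4, middle_comul, hK]
      intro x
      exact (YDHopf.yetterDrinfeld x d).symm
  rw [comul_inclB, comul_j, ← key, ← s1, show inclB k H B b = of k H B (b ⊗ₜ 1) from rfl,
    j_mul_of, LinearMap.mulRight_one, comul_of]

lemma comul_mul (x y : Biproduct k H B) :
    comul (R := k) (x * y) = comul (R := k) x * comul (R := k) y := by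
  have hj : ∀ (x : Biproduct k H B) (g : H), comul (R := k) (x * j k H B g) =
      comul (R := k) x * comul (R := k) (j k H B g) := by
    intro x g
    induction x using induction_of with
    | h2 _ _ h h' => simp only [LinearMap.map_add, add_mul, h, h']
    | h1 b h => exact comul_mul_j b h g
  have hb : ∀ (x : Biproduct k H B) (b : B), comul (R := k) (x * inclB k H B b) =
      comul (R := k) x * comul (R := k) (inclB k H B b) := by
    intro x b'
    induction x using induction_of with
    | h2 _ _ h h' => simp only [LinearMap.map_add, add_mul, h, h']
    | h1 b h =>
      rw [← inclB_mul_j, hj, mul_assoc, mul_assoc, ← comul_j_mul_inclB]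
      have h1 : ∀ z : B ⊗[k] H, comul (R := k) (inclB k H B b * of k H B z) =
          comul (R := k) (inclB k H B b) * comul (R := k) (of k H B z) := by
        intro z
        induction z using tensor_ind with
        | add _ _ h h' => simp only [LinearMap.map_add, LinearEquiv.map_add, mul_add, h, h']
        | tmul c g =>
          rw [← inclB_mul_j c g, ← mul_assoc, hj, ← inclB_mul, comul_inclB_mul_inclB, hj,
            mul_assoc]
      exact h1 ((of k H B).symm (j k H B h * inclB k H B b'))
  induction y using induction_of with
  | h2 _ _ h h' => simp only [LinearMap.map_add, mul_add, h, h']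
  | h1 b h => rw [← inclB_mul_j, ← mul_assoc, hj, hb, hj, mul_assoc]

lemma counit_j (h : H) : counit (R := k) (j k H B h) = counit (R := k) h := by
  rw [show j k H B h = of k H B (1 ⊗ₜ h) from rfl, counit_of, YDHopf.counit_one (k := k) (H := H),
    one_mul]

lemma counit_inclB (b : B) : counit (R := k) (inclB k H B b) = counit (R := k) b := by
  rw [show inclB k H B b = of k H B (b ⊗ₜ 1) from rfl, counit_of, Bialgebra.counit_one, mul_one]

lemma counit_mul (x y : Biproduct k H B) :
    counit (R := k) (x * y) = counit (R := k) x * counit (R := k) y := by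
  induction x using induction_of with
  | h2 _ _ h h' => simp only [LinearMap.map_add, add_mul, h, h']
  | h1 b h =>
    induction y using induction_of with
    | h2 _ _ h h' => simp only [LinearMap.map_add, mul_add, h, h']
    | h1 b' h' =>
      rw [← inclB_mul_j b h, mul_assoc, j_mul_of]
      have h1 : ∀ t : H ⊗[k] H, counit (R := k) (inclB k H B b *
          of k H B (TensorProduct.map (actAt k b') (LinearMap.mulRight k h') t)) =
          counit (R := k) b * counit (R := k) b' * counit (R := k) h' *
            counit (R := k) (TensorProduct.lid k H ((counit (R := k)).rTensor H t)) := by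
        intro t
        induction t using tensor_ind with
        | add _ _ h h' => simp only [LinearMap.map_add, LinearEquiv.map_add, mul_add, h, h']
        | tmul x u =>
          rw [TensorProduct.map_tmul, actAt_apply, inclB_mul_of, counit_of,
            YDHopf.counit_mul (k := k) (H := H), YDHopf.counit_smul (k := k) (H := H)]
          simp only [LinearMap.mulRight_apply, Bialgebra.counit_mul, LinearMap.rTensor_tmul,
            TensorProduct.lid_tmul, LinearMap.map_smul, smul_eq_mul]
          ring
      rw [h1, rTensor_counit_comul, inclB_mul_j, counit_of, counit_of, TensorProduct.lid_tmul,
        one_smul]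
      ring

noncomputable instance : Bialgebra k (Biproduct k H B) :=
  Bialgebra.mk' k (Biproduct k H B)
    (by rw [← j_one, counit_j, Bialgebra.counit_one])
    (fun {x y} => counit_mul x y)
    (by
      rw [← j_one, comul_j, Bialgebra.comul_one, Algebra.TensorProduct.one_def,
        TensorProduct.map_tmul, j_one, ← Algebra.TensorProduct.one_def])
    (fun {x y} => comul_mul x y)

/-- The antipode of `B`: the convolution inverse of the identity. -/
noncomputable def braidedAntipode (k : Type u) (H : Type v) (B : Type w) [Field k] [Ring H]
    [HopfAlgebra k H] [Ring B] [Algebra k B] [Coalgebra k B] [Module H B] [IsScalarTower k H B]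
    [LeftComodule k H B] [YDHopf k H B] : B →ₗ[k] B :=
  (YDHopf.exists_convInverse (k := k) (H := H) (B := B)).choose

/-- `(y ⊗ e) ⊗ h ↦ j(S(y h)) (S_B(e) × 1)`. -/
noncomputable def auxS (k : Type u) (H : Type v) (B : Type w) [Field k] [Ring H]
    [HopfAlgebra k H] [Ring B] [Algebra k B] [Coalgebra k B] [Module H B] [IsScalarTower k H B]
    [LeftComodule k H B] [YDHopf k H B] : (H ⊗[k] B) ⊗[k] H →ₗ[k] Biproduct k H B :=
  LinearMap.mul' k (Biproduct k H B) ∘ₗ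
    TensorProduct.map (j k H B ∘ₗ HopfAlgebra.antipode k ∘ₗ LinearMap.mul' k H)
      (inclB k H B ∘ₗ braidedAntipode k H B) ∘ₗ
    (TensorProduct.rightComm k H B H).toLinearMap

lemma auxS_tmul (y h : H) (e : B) : auxS k H B ((y ⊗ₜ e) ⊗ₜ h) =
    j k H B (HopfAlgebra.antipode k (y * h)) * inclB k H B (braidedAntipode k H B e) := by
  simp [auxS]

/-- The antipode `b × h ↦ (1 × S(b₍₋₁₎ h)) (S_B(b₍₀₎) × 1)`. -/
noncomputable def antipodeMap (k : Type u) (H : Type v) (B : Type w) [Field k] [Ring H]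
    [HopfAlgebra k H] [Ring B] [Algebra k B] [Coalgebra k B] [Module H B] [IsScalarTower k H B]
    [LeftComodule k H B] [YDHopf k H B] : Biproduct k H B →ₗ[k] Biproduct k H B :=
  auxS k H B ∘ₗ LeftComodule.coaction.rTensor H ∘ₗ (of k H B).symm.toLinearMap

lemma antipodeMap_of (b : B) (h : H) : antipodeMap k H B (of k H B (b ⊗ₜ h)) =
    auxS k H B (LeftComodule.coaction b ⊗ₜ h) := rfl

lemma antipode_left (x : Biproduct k H B) :
    LinearMap.mul' k (Biproduct k H B) ((antipodeMap k H B).rTensor _ (comul (R := k) x)) =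
      algebraMap k (Biproduct k H B) (counit (R := k) x) := by
  induction x using induction_of with
  | h2 _ _ h h' => simp only [LinearMap.map_add, RingHom.map_add, h, h']
  | h1 b h =>
    let Y : H ⊗[k] (B ⊗[k] B) →ₗ[k] (H ⊗[k] H →ₗ[k] Biproduct k H B) :=
      TensorProduct.lift (LinearMap.mk₂ k (fun y s =>
        LinearMap.mul' k (Biproduct k H B) ∘ₗ TensorProduct.map
          (LinearMap.mulRight k (inclB k H B (LinearMap.mul' k B
            ((braidedAntipode k H B).rTensor B s))) ∘ₗ j k H B ∘ₗ HopfAlgebra.antipode k ∘ₗ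
            LinearMap.mulLeft k y) (j k H B))
        (by intros; ext; simp [add_mul]) (by intros; ext; simp)
        (by intros; ext; simp [mul_add, add_mul]) (by intros; ext; simp))
    have hY : ∀ y s h h', Y (y ⊗ₜ s) (h ⊗ₜ h') = j k H B (HopfAlgebra.antipode k (y * h)) *
        inclB k H B (LinearMap.mul' k B ((braidedAntipode k H B).rTensor B s)) * j k H B h' := by
      intros; simp [Y]
    have h1 : ∀ s : B ⊗[k] B, LinearMap.mul' k (Biproduct k H B) ((antipodeMap k H B).rTensor _
        (TensorProduct.map (of k H B).toLinearMap (of k H B).toLinearMap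
          ((TensorProduct.assoc k B H (B ⊗[k] H)).symm ((lam k H B).lTensor B
            (TensorProduct.assoc k B B H (s ⊗ₜ h)))))) =
        Y (codiag (LeftComodule.coaction (k := k) (C := H))
          (LeftComodule.coaction (k := k) (C := H)) s) (comul (R := k) h) := by
      intro s
      induction s using tensor_ind with
      | add _ _ h h' => simp only [LinearMap.map_add, LinearEquiv.map_add, add_tmul, h, h',
          LinearMap.add_apply]
      | tmul c d =>
        simp only [TensorProduct.assoc_tmul, LinearMap.lTensor_tmul, lam_tmul, codiag_tmul]
        generalize comul (R := k) h = u
        generalize LeftComodule.coaction (k := k) (C := H) d = q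
        induction u using tensor_ind with
        | add _ _ h h' => simp only [LinearMap.map_add, LinearEquiv.map_add, tmul_add, h, h']
        | tmul h1 h2 =>
          induction q using tensor_ind with
          | add _ _ h h' => simp only [LinearMap.map_add, LinearEquiv.map_add, tmul_add, add_tmul,
              h, h', LinearMap.add_apply]
          | tmul q e =>
            rw [mulFirst_tmul, TensorProduct.assoc_symm_tmul, TensorProduct.map_tmul,
              LinearMap.rTensor_tmul, LinearEquiv.coe_coe, antipodeMap_of, LinearMap.mul'_apply]
            generalize LeftComodule.coaction (k := k) (C := H) c = p
            induction p using tensor_ind with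
            | add _ _ h h' => simp only [LinearMap.map_add, add_tmul, LinearMap.add_apply, add_mul,
                h, h']
            | tmul p c =>
              rw [mulFirst_tmul, hY, auxS_tmul, ← inclB_mul_j e,
                LinearMap.rTensor_tmul, LinearMap.mul'_apply, inclB_mul]
              simp only [mul_assoc]
    have h2 : ∀ (t : H ⊗[k] B) (u : H ⊗[k] H), Y ((comul (R := k)).lTensor H t) u =
        LinearMap.mul' k (Biproduct k H B) (TensorProduct.map (j k H B) (j k H B)
          ((HopfAlgebra.antipode k).rTensor H ((LinearMap.mulLeft k (TensorProduct.rid k H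
            ((counit (R := k)).lTensor H t))).rTensor H u))) := by
      intro t u
      induction u using tensor_ind with
      | add _ _ h h' => simp only [LinearMap.map_add, h, h']
      | tmul h1 h2 =>
        induction t using tensor_ind with
        | add _ _ h h' =>
          simp only [LinearMap.map_add, LinearMap.add_apply, h, h', LinearEquiv.map_add]
          simp [add_mul]
        | tmul y e =>
          have h3 := LinearMap.congr_fun
            (YDHopf.exists_convInverse (k := k) (H := H) (B := B)).choose_spec.1 e
          rw [LinearMap.lTensor_tmul, hY]
          have h4 : (LinearMap.mul' k B) ((braidedAntipode k H B).rTensor B (comul e)) =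
            algebraMap k B (counit e) := h3
          rw [h4, Algebra.algebraMap_eq_smul_one, LinearMap.map_smul, inclB_one]
          simp
    rw [comul_of, smashComul_tmul, h1, YDHopf.coaction_comul, h2, YDHopf.coaction_counit,
      counit_of]
    have h5 : ∀ u : H ⊗[k] H, LinearMap.mul' k (Biproduct k H B)
        (TensorProduct.map (j k H B) (j k H B) u) = j k H B (LinearMap.mul' k H u) := by
      intro u
      induction u using tensor_ind with
      | add _ _ h h' => simp only [LinearMap.map_add, h, h']
      | tmul _ _ => simp [j_mul]
    have h6 : LinearMap.mulLeft k (counit (R := k) b • (1 : H)) =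
        counit (R := k) b • LinearMap.id := by ext; simp
    rw [h5, h6, LinearMap.rTensor_smul, LinearMap.smul_apply, LinearMap.rTensor_id,
      LinearMap.id_apply, LinearMap.map_smul, LinearMap.map_smul, LinearMap.map_smul,
      HopfAlgebra.mul_antipode_rTensor_comul_apply, Algebra.algebraMap_eq_smul_one,
      LinearMap.map_smul, j_one, smul_smul, Algebra.algebraMap_eq_smul_one]

lemma antipode_right (x : Biproduct k H B) :
    LinearMap.mul' k (Biproduct k H B) ((antipodeMap k H B).lTensor _ (comul (R := k) x)) =
      algebraMap k (Biproduct k H B) (counit (R := k) x) := by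
  induction x using induction_of with
  | h2 _ _ h h' => simp only [LinearMap.map_add, RingHom.map_add, h, h']
  | h1 b h =>
    let Θ (u : H ⊗[k] H) : H ⊗[k] H →ₗ[k] H :=
      LinearMap.mul' k H ∘ₗ (HopfAlgebra.antipode k).lTensor H ∘ₗ LinearMap.mulRight k u
    let Y (c : B) (u : H ⊗[k] H) : H ⊗[k] (H ⊗[k] B) →ₗ[k] Biproduct k H B :=
      LinearMap.mulLeft k (inclB k H B c) ∘ₗ LinearMap.mul' k (Biproduct k H B) ∘ₗ
        TensorProduct.map (j k H B ∘ₗ Θ u) (inclB k H B ∘ₗ braidedAntipode k H B) ∘ₗ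
          (TensorProduct.assoc k H H B).symm.toLinearMap
    have hY : ∀ c u y z e, Y c u (y ⊗ₜ (z ⊗ₜ e)) = inclB k H B c * (j k H B (LinearMap.mul' k H
        ((HopfAlgebra.antipode k).lTensor H ((y ⊗ₜ z) * u))) *
        inclB k H B (braidedAntipode k H B e)) := by
      intros; rfl
    have hY0 : ∀ c, Y c 0 = 0 := by
      intro c; ext; simp [hY]
    have hYa : ∀ c u v, Y c (u + v) = Y c u + Y c v := by
      intro c u v; ext; simp [hY, mul_add, add_mul]
    have h1 : ∀ (c : B) (t : H ⊗[k] B) (u : H ⊗[k] H),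
        LinearMap.mul' k (Biproduct k H B) ((antipodeMap k H B).lTensor _
          (TensorProduct.map (of k H B).toLinearMap (of k H B).toLinearMap
          ((TensorProduct.assoc k B H (B ⊗[k] H)).symm (c ⊗ₜ mulFirst k H B H (t ⊗ₜ u))))) =
        Y c u (LeftComodule.coaction.lTensor H t) := by
      intro c t u
      induction u using tensor_ind with
      | add _ _ h h' => simp only [LinearMap.map_add, LinearEquiv.map_add, tmul_add, h, h', hYa,
          LinearMap.add_apply]
      | tmul h1 h2 =>
        induction t using tensor_ind with
        | add _ _ h h' => simp only [LinearMap.map_add, LinearEquiv.map_add, tmul_add, add_tmul,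
            h, h']
        | tmul y e =>
          rw [mulFirst_tmul, TensorProduct.assoc_symm_tmul, TensorProduct.map_tmul,
            LinearMap.lTensor_tmul, LinearEquiv.coe_coe, antipodeMap_of,
            LinearMap.mul'_apply, LinearMap.lTensor_tmul]
          generalize LeftComodule.coaction (k := k) (C := H) e = p
          induction p using tensor_ind with
          | add _ _ h h' => simp only [LinearMap.map_add, add_tmul, tmul_add, mul_add, h, h']
          | tmul z f =>
            rw [hY, auxS_tmul, ← inclB_mul_j, Algebra.TensorProduct.tmul_mul_tmul,
              LinearMap.lTensor_tmul, LinearMap.mul'_apply]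
            simp only [j_mul, mul_assoc]
    have h2 : ∀ (c : B) (t : H ⊗[k] B), Y c (comul (R := k) h)
        (TensorProduct.assoc k H H B ((comul (R := k)).rTensor B t)) =
        counit (R := k) h • inclB k H B (c * braidedAntipode k H B
          (TensorProduct.lid k B ((counit (R := k)).rTensor B t))) := by
      intro c t
      induction t using tensor_ind with
      | add _ _ h h' => simp only [LinearMap.map_add, LinearEquiv.map_add, mul_add, smul_add, h, h']
      | tmul y e =>
        have h3 : ∀ v : H ⊗[k] H, Y c (comul (R := k) h) (TensorProduct.assoc k H H B (v ⊗ₜ e)) =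
            inclB k H B c * (j k H B (LinearMap.mul' k H
              ((HopfAlgebra.antipode k).lTensor H (v * comul (R := k) h))) *
              inclB k H B (braidedAntipode k H B e)) := by
          intro v
          simp only [Y, LinearMap.comp_apply, LinearEquiv.coe_coe, LinearEquiv.symm_apply_apply]
          rfl
        rw [LinearMap.rTensor_tmul, h3, ← Bialgebra.comul_mul,
          HopfAlgebra.mul_antipode_lTensor_comul_apply, Algebra.algebraMap_eq_smul_one,
          LinearMap.map_smul, j_one, Bialgebra.counit_mul, LinearMap.rTensor_tmul,
          TensorProduct.lid_tmul, LinearMap.map_smul, mul_smul_comm, LinearMap.map_smul,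
          inclB_mul, smul_mul_assoc, one_mul, mul_smul_comm, smul_smul, mul_comm]
    have h3 := LinearMap.congr_fun
      (YDHopf.exists_convInverse (k := k) (H := H) (B := B)).choose_spec.2 b
    have h4 : (LinearMap.mul' k B) ((braidedAntipode k H B).lTensor B (comul b)) =
      algebraMap k B (counit b) := h3
    have h5 : ∀ s : B ⊗[k] B, LinearMap.mul' k (Biproduct k H B) ((antipodeMap k H B).lTensor _
        (TensorProduct.map (of k H B).toLinearMap (of k H B).toLinearMap
          ((TensorProduct.assoc k B H (B ⊗[k] H)).symm ((lam k H B).lTensor B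
            (TensorProduct.assoc k B B H (s ⊗ₜ h)))))) =
        counit (R := k) h • inclB k H B
          (LinearMap.mul' k B ((braidedAntipode k H B).lTensor B s)) := by
      intro s
      induction s using tensor_ind with
      | add _ _ h h' => simp only [LinearMap.map_add, LinearEquiv.map_add, add_tmul, h, h',
          smul_add]
      | tmul c d =>
        have h6 := LinearMap.congr_fun (LeftComodule.coassoc (k := k) (C := H) (M := B)) d
        have h7 := LinearMap.congr_fun
          (LeftComodule.counit_coaction (k := k) (C := H) (M := B)) d
        simp only [LinearMap.comp_apply, LinearEquiv.coe_coe] at h6 h7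
        rw [TensorProduct.assoc_tmul, LinearMap.lTensor_tmul, lam_tmul, h1, ← h6, h2, h7]
        simp
    rw [comul_of, smashComul_tmul, h5, h4, counit_of, Algebra.algebraMap_eq_smul_one,
      LinearMap.map_smul, inclB_one, smul_smul, Algebra.algebraMap_eq_smul_one, mul_comm]

noncomputable instance : HopfAlgebra k (Biproduct k H B) where
  antipode := antipodeMap k H B
  mul_antipode_rTensor_comul := LinearMap.ext antipode_left
  mul_antipode_lTensor_comul := LinearMap.ext antipode_right

end
end Biproduct

section Endomorphisms

variable (k : Type u) (H : Type v) (B : Type w) [Field k] [Ring H] [HopfAlgebra k H]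
  [Ring B] [Algebra k B] [Coalgebra k B] [Module H B] [IsScalarTower k H B]
  [LeftComodule k H B] [YDHopf k H B]

/-- The monoid `End_{YD-Hopf}(B)`, under composition, of the linear endomorphisms of `B` which are
algebra and coalgebra maps and also maps of left `H`-modules and of left `H`-comodules. -/
def EndYDHopf : Submonoid (B →ₐc[k] B) where
  carrier := {f | (∀ (h : H) (b : B), f (h • b) = h • f b) ∧
    ∀ b : B, LeftComodule.coaction (k := k) (C := H) (f b) =
      (f : B →ₗ[k] B).lTensor H (LeftComodule.coaction b)}
  one_mem' := ⟨fun _ _ => rfl, fun b =>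
    (LinearMap.congr_fun (LinearMap.lTensor_id H B) (LeftComodule.coaction (k := k) b)).symm⟩
  mul_mem' := by
    rintro f g ⟨hf, hf'⟩ ⟨hg, hg'⟩
    refine ⟨fun h b => ?_, fun b => ?_⟩
    · rw [BialgHom.mul_apply, BialgHom.mul_apply, hg, hf]
    · rw [BialgHom.mul_apply, hf', hg', ← LinearMap.comp_apply, ← LinearMap.lTensor_comp]
      rfl

/-- The group `Aut_{YD-Hopf}(B)` of units of `End_{YD-Hopf}(B)`. -/
abbrev AutYDHopf := (EndYDHopf k H B)ˣ

/-- The monoid `End_Hopf(A, π, j)`, under composition, of the Hopf algebra endomorphisms `F` of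
`A = B × H` such that `π ∘ F = π` and `F ∘ j = j`. -/
def EndHopf : Submonoid (Biproduct k H B →ₐc[k] Biproduct k H B) where
  carrier := {F | (∀ x, Biproduct.π k H B (F x) = Biproduct.π k H B x) ∧
    ∀ h, F (Biproduct.j k H B h) = Biproduct.j k H B h}
  one_mem' := ⟨fun _ => rfl, fun _ => rfl⟩
  mul_mem' := by
    rintro F G ⟨hF, hF'⟩ ⟨hG, hG'⟩
    refine ⟨fun x => ?_, fun h => ?_⟩
    · rw [BialgHom.mul_apply, hF, hG]
    · rw [BialgHom.mul_apply, hG', hF']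

/-- The group `Aut_Hopf(A, π, j)`: the subgroup of the group `Aut_Hopf(A)` of all Hopf algebra
automorphisms of `A = B × H` which consists of those `F` such that `π ∘ F = π` and `F ∘ j = j`. -/
def AutHopf : Subgroup (Biproduct k H B →ₐc[k] Biproduct k H B)ˣ where
  carrier := {F | (∀ x, Biproduct.π k H B (F.val x) = Biproduct.π k H B x) ∧
    ∀ h, F.val (Biproduct.j k H B h) = Biproduct.j k H B h}
  one_mem' := (EndHopf k H B).one_mem
  mul_mem' := fun {F G} hF hG => (EndHopf k H B).mul_mem (x := F.val) (y := G.val) hF hG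
  inv_mem' := by
    rintro F ⟨hF, hF'⟩
    have h1 : ∀ x, F.val (F⁻¹.val x) = x := fun x => by
      rw [← BialgHom.mul_apply, Units.mul_inv, BialgHom.one_apply]
    have h2 : ∀ x, F⁻¹.val (F.val x) = x := fun x => by
      rw [← BialgHom.mul_apply, Units.inv_mul, BialgHom.one_apply]
    refine ⟨fun x => ?_, fun h => ?_⟩
    · rw [← hF, h1]
    · conv_lhs => rw [← hF', h2]

end Endomorphisms

end YD

/-! The product and coproduct of `A = B × H` are built from the structure of `H` and from the
product, coproduct, `H`-action and `H`-coaction of `B`. A map `f` of `B` that respects the last four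
therefore makes `f ⊗ id` a bialgebra map of `A` (`EndYDHopf.mapB_mul`, `EndYDHopf.comul_mapB`).
Between Hopf algebras such a map commutes with the antipodes automatically. The unit and counit of
`B` account for `F ∘ j = j` and `π ∘ F = π`.

The converse rests on coinvariants. `A` is a right `H`-comodule through `(id ⊗ π) ∘ Δ`, which on `B
⊗ H` is just `id ⊗ Δ_H`, so its coinvariants are exactly `B × 1` (`lTensor_π_comul_of`,
`eq_inclB_projB`). A coalgebra map `F` with `π ∘ F = π` is a map of comodules and preserves
coinvariants, whence `F(b × 1) = f(b) × 1` for a linear map `f` (`EndHopf.apply_inclB`). As `b × h =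
(b × 1) j(h)` and `F ∘ j = j`, this gives `F = f ⊗ id` (`EndHopf.apply_of`).

It remains to see that `f` preserves the structure of `B`. With `p = projB : b × h ↦ ε(h) b`, all of
it can be read off from `A`: `b ↦ b × 1` is an injective algebra map, `Δ_B(b) = (p ⊗ p) Δ(b × 1)`,
`ρ(b) = (π ⊗ p) Δ(b × 1)` and `h · b = p(j(h) (b × 1))`. The relations `p ∘ F = f ∘ p`, `π ∘ F = π`
and `F ∘ j = j` carry these formulas from `b` to `f(b)`.

The statement on automorphisms follows by taking units, since the conditions on `F` pass to `F⁻¹`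
(`units_endHopf`). -/

namespace YD
-- Reading the structure of B off the biproduct
namespace Biproduct

open Coalgebra
open TensorProduct (add_tmul tmul_add)

variable {k : Type u} {H : Type v} {B : Type w} [Field k] [Ring H] [HopfAlgebra k H]
  [Ring B] [Algebra k B]

/-- The map `A → B`, `b × h ↦ ε(h) b`. -/
noncomputable def projB (k : Type u) (H : Type v) (B : Type w) [Field k] [Ring H]
    [HopfAlgebra k H] [Ring B] [Algebra k B] : Biproduct k H B →ₗ[k] B :=
  (TensorProduct.rid k B).toLinearMap ∘ₗ (counit (R := k) (A := H)).lTensor B ∘ₗ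
    (of k H B).symm.toLinearMap

@[simp] lemma projB_of (b : B) (h : H) :
    projB k H B (of k H B (b ⊗ₜ h)) = counit (R := k) h • b := by
  simp [projB]

@[simp] lemma projB_inclB (b : B) : projB k H B (inclB k H B b) = b := by
  rw [show inclB k H B b = of k H B (b ⊗ₜ 1) from rfl, projB_of, Bialgebra.counit_one, one_smul]

lemma inclB_injective : Function.Injective (inclB k H B) :=
  Function.LeftInverse.injective projB_inclB

/-- `f ↦ (b × h ↦ f(b) × h)` on linear maps. -/
noncomputable def mapB (k : Type u) (H : Type v) (B : Type w) [Field k] [Ring H]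
    [HopfAlgebra k H] [Ring B] [Algebra k B] (f : B →ₗ[k] B) :
    Biproduct k H B →ₗ[k] Biproduct k H B :=
  (of k H B).toLinearMap ∘ₗ f.rTensor H ∘ₗ (of k H B).symm.toLinearMap

@[simp] lemma mapB_of (f : B →ₗ[k] B) (b : B) (h : H) :
    mapB k H B f (of k H B (b ⊗ₜ h)) = of k H B (f b ⊗ₜ h) := rfl

variable [Coalgebra k B] [Module H B] [IsScalarTower k H B] [LeftComodule k H B] [YDHopf k H B]

/-- In `A` one has `j(h) (b × 1) = h₍₁₎ · b × h₍₂₎`, and `projB` applies the counit to the second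
factor. This recovers the action of `H` on `B` from the product of `A`. -/
lemma projB_j_mul_inclB (h : H) (b : B) :
    projB k H B (j k H B h * inclB k H B b) = h • b := by
  have h1 : ∀ t : H ⊗[k] H, projB k H B
      (of k H B (TensorProduct.map (actAt k b) (LinearMap.mulRight k 1) t)) =
        TensorProduct.rid k H ((counit (R := k)).lTensor H t) • b := by
    intro t
    induction t using tensor_ind with
    | add _ _ h h' => simp only [LinearMap.map_add, LinearEquiv.map_add, add_smul, h, h']
    | tmul x y => simp
  rw [show inclB k H B b = of k H B (b ⊗ₜ 1) from rfl, j_mul_of, h1, lTensor_counit_comul]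
  simp

/-- Since `Δ(b × 1) = (b₍₁₎ × b₍₂₎₍₋₁₎) ⊗ (b₍₂₎₍₀₎ × 1)`, the first `projB` turns `b₍₂₎₍₋₁₎` into
its counit, and the counit axiom of the coaction restores `b₍₂₎`. -/
lemma map_projB_projB_comul_inclB (b : B) :
    TensorProduct.map (projB k H B) (projB k H B) (comul (R := k) (inclB k H B b)) =
      comul (R := k) b := by
  rw [comul_inclB]
  generalize comul (R := k) b = s
  induction s using tensor_ind with
  | add _ _ h h' => simp only [LinearMap.map_add, h, h']
  | tmul c d =>
    have h1 : ∀ t : H ⊗[k] B,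
        TensorProduct.map (projB k H B) (projB k H B) (auxW k H B (c ⊗ₜ t)) =
          c ⊗ₜ TensorProduct.lid k B ((counit (R := k)).rTensor B t) := by
      intro t
      induction t using tensor_ind with
      | add _ _ h h' => simp only [LinearMap.map_add, LinearEquiv.map_add, tmul_add, h, h']
      | tmul x e => simp [auxW_tmul, TensorProduct.smul_tmul]
    have h2 := LinearMap.congr_fun (LeftComodule.counit_coaction (k := k) (C := H) (M := B)) d
    rw [LinearMap.comp_apply] at h2
    rw [LinearMap.lTensor_tmul, h1, h2]
    simp

/-- In the same formula for `Δ(b × 1)`, `π` on the left leg produces `ε(b₍₁₎) b₍₂₎₍₋₁₎ ⊗ b₍₂₎₍₀₎`,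
which is the coaction of `b` by the counit axiom of `B`. -/
lemma map_π_projB_comul_inclB (b : B) :
    TensorProduct.map (π k H B) (projB k H B) (comul (R := k) (inclB k H B b)) =
      LeftComodule.coaction b := by
  have h1 : ∀ s : B ⊗[k] B, TensorProduct.map (π k H B) (projB k H B)
      (auxW k H B (LeftComodule.coaction.lTensor B s)) =
        LeftComodule.coaction (TensorProduct.lid k B ((counit (R := k)).rTensor B s)) := by
    intro s
    induction s using tensor_ind with
    | add _ _ h h' => simp only [LinearMap.map_add, LinearEquiv.map_add, h, h']
    | tmul c d =>
      rw [LinearMap.lTensor_tmul, LinearMap.rTensor_tmul, TensorProduct.lid_tmul,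
        LinearMap.map_smul]
      generalize LeftComodule.coaction (k := k) (C := H) d = t
      induction t using tensor_ind with
      | add _ _ h h' => simp only [LinearMap.map_add, tmul_add, smul_add, h, h']
      | tmul x e => simp [auxW_tmul, TensorProduct.smul_tmul']
  rw [comul_inclB, h1, rTensor_counit_comul]
  simp

/-! ### The coinvariants of A over H -/

/-- The coaction `(id ⊗ π) ∘ Δ` of `H` on `A` is `id_B ⊗ Δ_H`. -/
lemma lTensor_π_comul_of (b : B) (h : H) :
    (π k H B).lTensor (Biproduct k H B) (comul (R := k) (of k H B (b ⊗ₜ h))) =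
      ((of k H B).toLinearMap ∘ₗ TensorProduct.mk k B H b).rTensor H (comul (R := k) h) := by
  -- Here `c` stands for `b₍₁₎`, `t` for the coaction of `b₍₂₎` and `u` for `Δ(h)`. As `π` evaluates
  -- `ε` on `b₍₂₎₍₀₎`, what is left of `t` is the factor `b₍₂₎₍₋₁₎ ε(b₍₂₎₍₀₎)` to the left of
  -- `h₍₁₎`.
  have h1 : ∀ (c : B) (t : H ⊗[k] B) (u : H ⊗[k] H), (π k H B).lTensor (Biproduct k H B)
      (TensorProduct.map (of k H B).toLinearMap (of k H B).toLinearMap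
        ((TensorProduct.assoc k B H (B ⊗[k] H)).symm (c ⊗ₜ mulFirst k H B H (t ⊗ₜ u)))) =
      ((of k H B).toLinearMap ∘ₗ TensorProduct.mk k B H c ∘ₗ
        LinearMap.mulLeft k (TensorProduct.rid k H ((counit (R := k)).lTensor H t))).rTensor H
          u := by
    intro c t u
    induction u using tensor_ind with
    | add _ _ h h' => simp only [LinearMap.map_add, LinearEquiv.map_add, tmul_add, h, h']
    | tmul x y =>
      induction t using tensor_ind with
      | add _ _ h h' =>
        -- On the right `t` occurs inside a linear map, so the induction hypotheses are evaluated at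
        -- `x ⊗ y` before they are added.
        simp only [LinearMap.rTensor_tmul, LinearMap.comp_apply, LinearMap.mulLeft_apply] at h h'
        simp only [LinearMap.rTensor_tmul, LinearMap.comp_apply, LinearMap.mulLeft_apply,
          LinearMap.map_add, LinearEquiv.map_add, tmul_add, add_tmul, add_mul, h, h']
      | tmul z e =>
        simp [TensorProduct.smul_tmul', TensorProduct.tmul_smul, ← LinearEquiv.map_smul]
  have h2 : ∀ s : B ⊗[k] B, (π k H B).lTensor (Biproduct k H B)
      (TensorProduct.map (of k H B).toLinearMap (of k H B).toLinearMap
        ((TensorProduct.assoc k B H (B ⊗[k] H)).symm ((lam k H B).lTensor B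
          (TensorProduct.assoc k B B H (s ⊗ₜ h))))) =
      ((of k H B).toLinearMap ∘ₗ TensorProduct.mk k B H
        (TensorProduct.rid k B ((counit (R := k)).lTensor B s))).rTensor H
          (comul (R := k) h) := by
    intro s
    induction s using tensor_ind with
    | add _ _ h h' => simp only [LinearMap.map_add, LinearEquiv.map_add, add_tmul, h, h',
        LinearMap.comp_add, LinearMap.rTensor_add, LinearMap.add_apply]
    | tmul c d =>
      -- The remaining factor `d₍₋₁₎ ε(d₍₀₎)` equals `ε(d) 1` because `ε` is a comodule map. The
      -- scalar moves to `c`, where the counit axiom of `B` will absorb it.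
      rw [TensorProduct.assoc_tmul, LinearMap.lTensor_tmul, lam_tmul, h1,
        YDHopf.coaction_counit]
      congr 2
      ext x
      simp [TensorProduct.smul_tmul']
  rw [comul_of, smashComul_tmul, h2, lTensor_counit_comul]
  simp

/-- The hypothesis says that `x` is coinvariant. The map `T : (b × h) ⊗ g ↦ ε(h) b × g` is a left
inverse of the coaction, because `b × h` coacts to `(b × h₍₁₎) ⊗ h₍₂₎` and `ε(h₍₁₎) h₍₂₎ = h`.
Applying `T` to `x ⊗ 1` gives `projB x × 1`. -/
lemma eq_inclB_projB {x : Biproduct k H B}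
    (hx : (π k H B).lTensor (Biproduct k H B) (comul (R := k) x) = x ⊗ₜ 1) :
    x = inclB k H B (projB k H B x) := by
  let T : Biproduct k H B ⊗[k] H →ₗ[k] Biproduct k H B :=
    (of k H B).toLinearMap ∘ₗ (projB k H B).rTensor H
  have h1 : ∀ y : Biproduct k H B,
      T ((π k H B).lTensor (Biproduct k H B) (comul (R := k) y)) = y := by
    intro y
    induction y using induction_of with
    | h2 _ _ h h' => simp only [LinearMap.map_add, h, h']
    | h1 b h =>
      have h2 : ∀ u : H ⊗[k] H,
          T (((of k H B).toLinearMap ∘ₗ TensorProduct.mk k B H b).rTensor H u) =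
            of k H B (b ⊗ₜ TensorProduct.lid k H ((counit (R := k)).rTensor H u)) := by
        intro u
        induction u using tensor_ind with
        | add _ _ h h' => simp only [LinearMap.map_add, LinearEquiv.map_add, tmul_add, h, h']
        | tmul y z => simp [T, TensorProduct.smul_tmul']
      rw [lTensor_π_comul_of, h2, rTensor_counit_comul]
      simp
  calc x = T (x ⊗ₜ 1) := by rw [← hx, h1]
    _ = _ := rfl

end Biproduct

section Endomorphisms

open Coalgebra Biproduct
open TensorProduct (add_tmul tmul_add)

variable {k : Type u} {H : Type v} {B : Type w} [Field k] [Ring H] [HopfAlgebra k H]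
  [Ring B] [Algebra k B] [Coalgebra k B] [Module H B] [IsScalarTower k H B]
  [LeftComodule k H B] [YDHopf k H B]

/-! ### Extending an endomorphism of B to A -/

namespace EndYDHopf

/-- In `b (h₍₁₎ · b') × h₍₂₎ h'` only the product of `B` and the action on `B` meet `f`, so
multiplicativity and `H`-linearity of `f` suffice. -/
lemma mapB_mul (f : EndYDHopf k H B) (x y : Biproduct k H B) :
    mapB k H B (f.val : B →ₗ[k] B) (x * y) =
      mapB k H B (f.val : B →ₗ[k] B) x * mapB k H B (f.val : B →ₗ[k] B) y := by
  induction x using induction_of with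
  | h2 _ _ h h' => simp only [LinearMap.map_add, add_mul, h, h']
  | h1 b h =>
    induction y using induction_of with
    | h2 _ _ h h' => simp only [LinearMap.map_add, mul_add, h, h']
    | h1 b' h' =>
      -- Splitting `b × h` as `(b × 1) j(h)` makes both sides linear in `Δ(h)`, which can then be
      -- taken to be a pure tensor.
      rw [mapB_of, mapB_of, ← inclB_mul_j b, ← inclB_mul_j ((f.val : B →ₗ[k] B) b),
        mul_assoc, mul_assoc, j_mul_of, j_mul_of]
      generalize comul (R := k) h = t
      induction t using tensor_ind with
      | add _ _ h h' => simp only [LinearMap.map_add, LinearEquiv.map_add, mul_add, h, h']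
      | tmul x y => simp [inclB_mul_of, f.2.1]

/-- Dually to the product, `Δ(b × h)` involves `b` only through `Δ_B(b)` and the coaction of `b₍₂₎`,
and `f` commutes with both. -/
lemma comul_mapB (f : EndYDHopf k H B) (x : Biproduct k H B) :
    TensorProduct.map (mapB k H B (f.val : B →ₗ[k] B)) (mapB k H B (f.val : B →ₗ[k] B))
      (comul (R := k) x) = comul (R := k) (mapB k H B (f.val : B →ₗ[k] B) x) := by
  induction x using induction_of with
  | h2 _ _ h h' => simp only [LinearMap.map_add, h, h']
  | h1 b h =>
    have hf : comul (R := k) ((f.val : B →ₗ[k] B) b) =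
        TensorProduct.map (f.val : B →ₗ[k] B) (f.val : B →ₗ[k] B) (comul (R := k) b) :=
      (CoalgHomClass.map_comp_comul_apply f.val b).symm
    rw [mapB_of, comul_of, comul_of, smashComul_tmul, smashComul_tmul, hf]
    generalize comul (R := k) b = s
    induction s using tensor_ind with
    | add _ _ h h' => simp only [LinearMap.map_add, LinearEquiv.map_add, add_tmul, h, h']
    | tmul c d =>
      have hd : LeftComodule.coaction (k := k) (C := H) ((f.val : B →ₗ[k] B) d) =
        (f.val : B →ₗ[k] B).lTensor H (LeftComodule.coaction d) := f.2.2 d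
      rw [TensorProduct.map_tmul, TensorProduct.assoc_tmul, TensorProduct.assoc_tmul,
        LinearMap.lTensor_tmul, LinearMap.lTensor_tmul, lam_tmul, lam_tmul, hd]
      generalize LeftComodule.coaction (k := k) (C := H) d = t
      generalize comul (R := k) h = u
      induction t using tensor_ind with
      | add _ _ h h' =>
        simp only [LinearMap.map_add, LinearEquiv.map_add, add_tmul, tmul_add, h, h']
      | tmul y e =>
        induction u using tensor_ind with
        | add _ _ h h' => simp only [LinearMap.map_add, LinearEquiv.map_add, tmul_add, h, h']
        | tmul h1 h2 => simp

/-- The Hopf algebra endomorphism `b × h ↦ f(b) × h` of `A`. -/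
noncomputable def toEndHopf (f : EndYDHopf k H B) : EndHopf k H B where
  val := BialgHom.ofAlgHom
    (AlgHom.ofLinearMap (mapB k H B (f.val : B →ₗ[k] B))
      (by rw [one_def, mapB_of]; exact congrArg (fun b => of k H B (b ⊗ₜ 1)) (map_one f.val))
      (mapB_mul f))
    (by
      apply AlgHom.toLinearMap_injective
      ext x
      induction x using induction_of with
      | h2 _ _ h h' => simp only [map_add, h, h']
      | h1 b h =>
        exact congrArg (· * counit (R := k) h) (CoalgHomClass.counit_comp_apply f.val b))
    (by
      apply AlgHom.toLinearMap_injective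
      exact LinearMap.ext (comul_mapB f))
  property := by
    -- The condition on `π` amounts to `ε ∘ f = ε`, and the condition on `j` to `f(1) = 1`.
    refine ⟨fun x => ?_, fun h => ?_⟩
    · change π k H B (mapB k H B (f.val : B →ₗ[k] B) x) = _
      induction x using induction_of with
      | h2 _ _ h h' => simp only [map_add, h, h']
      | h1 b h =>
        rw [mapB_of, π_of, π_of]
        exact congrArg (· • h) (CoalgHomClass.counit_comp_apply f.val b)
    · exact congrArg (fun b => of k H B (b ⊗ₜ h)) (map_one f.val)

lemma toEndHopf_of (f : EndYDHopf k H B) (b : B) (h : H) :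
    (toEndHopf f).val (of k H B (b ⊗ₜ h)) = of k H B (f.val b ⊗ₜ h) := rfl

end EndYDHopf

/-! ### Restricting an endomorphism of A to B -/

namespace EndHopf

/-- The restriction of `F` to the coinvariants `B × 1` of `A`, as a linear map. -/
noncomputable def restrict (F : EndHopf k H B) : B →ₗ[k] B :=
  projB k H B ∘ₗ (F.val : Biproduct k H B →ₗ[k] Biproduct k H B) ∘ₗ inclB k H B

/-- The element `b × 1` is coinvariant and `F` preserves coinvariants: `(id ⊗ π) Δ F = (F ⊗ π F) Δ =
(F ⊗ id) (id ⊗ π) Δ`. So nothing is lost by the projection in the definition of `restrict`. -/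
lemma apply_inclB (F : EndHopf k H B) (b : B) :
    F.val (inclB k H B b) = inclB k H B (restrict F b) := by
  refine eq_inclB_projB ?_
  have h1 := CoalgHomClass.map_comp_comul_apply F.val (inclB k H B b)
  rw [← h1]
  have h2 : π k H B ∘ₗ (F.val : Biproduct k H B →ₗ[k] Biproduct k H B) = π k H B :=
    LinearMap.ext F.2.1
  have h3 : ∀ z, (π k H B).lTensor (Biproduct k H B) (TensorProduct.map
      (F.val : Biproduct k H B →ₗ[k] Biproduct k H B)
      (F.val : Biproduct k H B →ₗ[k] Biproduct k H B) z) =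
      (F.val : Biproduct k H B →ₗ[k] Biproduct k H B).rTensor H
        ((π k H B).lTensor (Biproduct k H B) z) := by
    intro z
    rw [← LinearMap.comp_apply, ← LinearMap.comp_apply, LinearMap.lTensor_comp_map, h2,
      LinearMap.rTensor_comp_lTensor]
  refine (h3 _).trans ?_
  -- At `h = 1` the coaction of `b × h` is `(b × 1) ⊗ 1`, which `F ⊗ id` sends to `F(b × 1) ⊗ 1`.
  rw [show inclB k H B b = of k H B (b ⊗ₜ 1) from rfl, lTensor_π_comul_of, Bialgebra.comul_one]
  rfl

/-- `F` is multiplicative on `b × h = (b × 1) j(h)` and fixes `j(h)`, so it is determined by its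
values on `B × 1`. -/
lemma apply_of (F : EndHopf k H B) (b : B) (h : H) :
    F.val (of k H B (b ⊗ₜ h)) = of k H B (restrict F b ⊗ₜ h) := by
  rw [← inclB_mul_j, map_mul, F.2.2, apply_inclB, inclB_mul_j]

/-- This intertwining relation transports the formulas that express the structure of `B` through
`projB`. -/
lemma projB_apply (F : EndHopf k H B) (x : Biproduct k H B) :
    projB k H B (F.val x) = restrict F (projB k H B x) := by
  induction x using induction_of with
  | h2 _ _ h h' => simp only [map_add, h, h']
  | h1 b h => rw [apply_of, projB_of, projB_of, LinearMap.map_smul]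

/-- The identity may be checked in `A`, since `inclB` is injective, multiplicative and intertwines
`restrict F` with `F`. -/
lemma restrict_mul (F : EndHopf k H B) (b b' : B) :
    restrict F (b * b') = restrict F b * restrict F b' := by
  apply inclB_injective (k := k) (H := H)
  rw [inclB_mul, ← apply_inclB, ← apply_inclB, ← apply_inclB, inclB_mul, map_mul]

lemma restrict_one (F : EndHopf k H B) : restrict F 1 = 1 := by
  apply inclB_injective (k := k) (H := H)
  rw [← apply_inclB, inclB_one, map_one]

lemma counit_restrict (F : EndHopf k H B) (b : B) :
    counit (R := k) (restrict F b) = counit (R := k) b := by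
  rw [← counit_inclB (k := k) (H := H), ← apply_inclB, CoalgHomClass.counit_comp_apply,
    counit_inclB]

lemma projB_comp (F : EndHopf k H B) :
    projB k H B ∘ₗ (F.val : Biproduct k H B →ₗ[k] Biproduct k H B) =
      restrict F ∘ₗ projB k H B :=
  LinearMap.ext (projB_apply F)

lemma comul_apply_inclB (F : EndHopf k H B) (b : B) :
    comul (R := k) (inclB k H B (restrict F b)) =
      TensorProduct.map (F.val : Biproduct k H B →ₗ[k] Biproduct k H B)
        (F.val : Biproduct k H B →ₗ[k] Biproduct k H B) (comul (R := k) (inclB k H B b)) := by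
  rw [← apply_inclB]
  exact (CoalgHomClass.map_comp_comul_apply F.val (inclB k H B b)).symm

/-- Write `p` for `projB` and `f` for `restrict F`. Then `Δ_B(f(b)) = (p ⊗ p) (F ⊗ F) Δ(b × 1) = (f
⊗ f) (p ⊗ p) Δ(b × 1)`, and the last expression is `(f ⊗ f) Δ_B(b)`. -/
lemma comul_restrict (F : EndHopf k H B) (b : B) :
    TensorProduct.map (restrict F) (restrict F) (comul (R := k) b) =
      comul (R := k) (restrict F b) := by
  rw [← map_projB_projB_comul_inclB (k := k) (H := H) (restrict F b), comul_apply_inclB,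
    ← LinearMap.comp_apply (TensorProduct.map (projB k H B) (projB k H B)),
    ← TensorProduct.map_comp, projB_comp, TensorProduct.map_comp, LinearMap.comp_apply,
    map_projB_projB_comul_inclB]

/-- The argument for the coproduct applies with `π` in the left leg, where `F` disappears because `π
∘ F = π`. -/
lemma coaction_restrict (F : EndHopf k H B) (b : B) :
    LeftComodule.coaction (k := k) (C := H) (restrict F b) =
      (restrict F).lTensor H (LeftComodule.coaction b) := by
  -- The identity is kept as a factor so that `TensorProduct.map_comp` can split off `id ⊗ restrict
  -- F`.
  have h1 : π k H B ∘ₗ (F.val : Biproduct k H B →ₗ[k] Biproduct k H B) =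
      LinearMap.id ∘ₗ π k H B :=
    LinearMap.ext F.2.1
  rw [← map_π_projB_comul_inclB (k := k) (H := H) (restrict F b), comul_apply_inclB,
    ← LinearMap.comp_apply (TensorProduct.map (π k H B) (projB k H B)),
    ← TensorProduct.map_comp, projB_comp, h1, TensorProduct.map_comp, LinearMap.comp_apply,
    map_π_projB_comul_inclB]
  rfl

/-- Since `j(h) = F(j(h))`, one has `j(h) F(b × 1) = F(j(h) (b × 1))`. Applying `projB` gives `h ·
f(b)` on the left and `f(h · b)` on the right, where `f = restrict F`. -/
lemma restrict_smul (F : EndHopf k H B) (h : H) (b : B) :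
    restrict F (h • b) = h • restrict F b := by
  rw [← projB_j_mul_inclB (k := k) h (restrict F b), ← apply_inclB, ← F.2.2 h, ← map_mul,
    projB_apply, projB_j_mul_inclB]

/-- The restriction of `F` to `B × 1`, as an endomorphism of the Hopf algebra `B`. -/
noncomputable def toEndYDHopf (F : EndHopf k H B) : EndYDHopf k H B where
  val :=
    { restrict F with
      counit_comp := LinearMap.ext (counit_restrict F)
      map_comp_comul := LinearMap.ext (comul_restrict F)
      map_one' := restrict_one F
      map_mul' := restrict_mul F }
  property := ⟨restrict_smul F, coaction_restrict F⟩

lemma toEndYDHopf_apply (F : EndHopf k H B) (b : B) :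
    (toEndYDHopf F).val b = restrict F b := rfl

end EndHopf

/-! ### The isomorphisms of monoids and of groups -/

/-- Endomorphisms of `A` are equal if they agree on the elements `b × h`. -/
lemma EndHopf.ext_of {F G : EndHopf k H B}
    (h : ∀ b g, F.val (of k H B (b ⊗ₜ g)) = G.val (of k H B (b ⊗ₜ g))) : F = G := by
  refine Subtype.ext (BialgHom.ext fun x => ?_)
  induction x using induction_of with
  | h2 _ _ h h' => simp only [map_add, h, h']
  | h1 b g => exact h b g

/-- The isomorphism `f ↦ (b × h ↦ f(b) × h)`. -/
noncomputable def endEquiv (k : Type u) (H : Type v) (B : Type w) [Field k] [Ring H]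
    [HopfAlgebra k H] [Ring B] [Algebra k B] [Coalgebra k B] [Module H B] [IsScalarTower k H B]
    [LeftComodule k H B] [YDHopf k H B] : EndYDHopf k H B ≃* EndHopf k H B where
  toFun := EndYDHopf.toEndHopf
  invFun := EndHopf.toEndYDHopf
  left_inv f := Subtype.ext (BialgHom.ext fun b => projB_inclB (k := k) (H := H) (f.val b))
  right_inv F := EndHopf.ext_of fun b g => by
    rw [EndYDHopf.toEndHopf_of, EndHopf.apply_of, EndHopf.toEndYDHopf_apply]
  -- On `b × h` both sides are `f(g(b)) × h` by definition.
  map_mul' f g := EndHopf.ext_of fun _ _ => rfl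

/-- Membership on the left demands the two conditions of both `F` and `F⁻¹`, on the right of `F`
alone. These agree because `π ∘ F = π` and `F ∘ j = j` imply the same for `F⁻¹`. -/
lemma units_endHopf : (EndHopf k H B).units = AutHopf k H B := by
  ext F
  rw [Submonoid.mem_units_iff]
  exact ⟨fun h => h.1, fun h => ⟨h, (AutHopf k H B).inv_mem h⟩⟩

/-- The isomorphism `f ↦ (b × h ↦ f(b) × h)` on automorphisms. -/
noncomputable def autEquiv (k : Type u) (H : Type v) (B : Type w) [Field k] [Ring H]
    [HopfAlgebra k H] [Ring B] [Algebra k B] [Coalgebra k B] [Module H B] [IsScalarTower k H B]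
    [LeftComodule k H B] [YDHopf k H B] : AutYDHopf k H B ≃* AutHopf k H B :=
  -- Taking units of `endEquiv` lands in the units of the monoid `EndHopf`. These are then viewed
  -- inside the unit group of all endomorphisms of `A`, where they form `AutHopf`.
  ((Units.mapEquiv (endEquiv k H B)).trans
    (EndHopf k H B).unitsEquivUnitsType.symm).trans (MulEquiv.subgroupCongr units_endHopf)

end Endomorphisms

end YD

theorem mainTheorem7 {k H B : Type*} [Field k] [Ring H] [HopfAlgebra k H]
    [Ring B] [Algebra k B] [Coalgebra k B] [Module H B] [IsScalarTower k H B]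
    [YD.LeftComodule k H B] [YD.YDHopf k H B] :
    (∃ Φ : YD.EndYDHopf k H B ≃* YD.EndHopf k H B,
      ∀ (f : YD.EndYDHopf k H B) (b : B) (h : H),
        (Φ f).val (YD.Biproduct.of k H B (b ⊗ₜ[k] h)) =
          YD.Biproduct.of k H B (f.val b ⊗ₜ[k] h)) ∧
    (∃ Ψ : YD.AutYDHopf k H B ≃* YD.AutHopf k H B,
      ∀ (f : YD.AutYDHopf k H B) (b : B) (h : H),
        (Ψ f).val.val (YD.Biproduct.of k H B (b ⊗ₜ[k] h)) =
          YD.Biproduct.of k H B (f.val.val b ⊗ₜ[k] h)) := by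
  exact ⟨⟨YD.endEquiv k H B, fun _ _ _ => rfl⟩, ⟨YD.autEquiv k H B, fun _ _ _ => rfl⟩⟩
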